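/- Let $G$ be an [IN] group, i.e. a locally compact (Hausdorff) group whose identity has a compact neighbourhood that is invariant under all inner automorphisms, with left Haar measure $dx$. Let $A$ be a complex Banach algebra (not necessarily unital) with a bounded $\mathcal{Z}(A)$-approximate identity, i.e. a norm-bounded net $(a_\alpha)$ in $A$ such that $a_\alpha z \to z$ for every $z$ in the centre $\mathcal{Z}(A)$ of $A$. Let $L^1(G,A)$ be the Banach algebra of (classes of) Bochner integrable functions $f : G \to A$ with norm $\|f\| = \int_G \|f(x)\|\,dx$ and convolution $(f*g)(x) = \int_G f(xy)\,g(y^{-1})\,dy$, let $L^1(G) = L^1(G,\mathbb{C})$, let $\mathcal{Z}(B)$ denote the centre of an algebra $B$, and let $\otimes^\gamma$ denote the Banach space projective tensor product, with the product determined by $(b\otimes c)(b'\otimes c') = bb'\otimes cc'$. Then $$\mathcal{Z}\big(L^1(G,A)\big) \cong \mathcal{Z}(L^1(G)) \otimes^\gamma \mathcal{Z}(A)$$ isometrically as Banach algebras; more precisely, there is an isometric algebra isomorphism $\Phi$ of $\mathcal{Z}(L^1(G)) \otimes^\gamma \mathcal{Z}(A)$ onto $\mathcal{Z}(L^1(G,A))$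 with $\Phi(f \otimes z)(x) = f(x) z$ for almost every $x \in G$, for all $f \in \mathcal{Z}(L^1(G))$ and $z \in \mathcal{Z}(A)$. -/

import Mathlib

open MeasureTheory Filter Topology
open scoped TensorProduct ENNReal

/-- A non-unital subalgebra of a complex Banach algebra, with the restricted norm, is a normed
space. -/
instance NonUnitalSubalgebra.instNormedSpaceComplex {B : Type*} [NonUnitalNormedRing B]
    [NormedSpace ℂ B] (S : NonUnitalSubalgebra ℂ B) : NormedSpace ℂ S where
  norm_smul_le c x := norm_smul_le c (x : B)

/-! ### The projective tensor product of Banach spaces and of Banach algebras -/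

/-- The algebraic tensor product `E ⊗ F` over `ℂ`, as a carrier for the projective norm. -/
def AlgProj (E F : Type*) [SeminormedAddCommGroup E] [NormedSpace ℂ E]
    [SeminormedAddCommGroup F] [NormedSpace ℂ F] : Type _ := E ⊗[ℂ] F

namespace AlgProj

section Space

variable {E F : Type*} [SeminormedAddCommGroup E] [NormedSpace ℂ E]
  [SeminormedAddCommGroup F] [NormedSpace ℂ F]

noncomputable instance : AddCommGroup (AlgProj E F) :=
  inferInstanceAs (AddCommGroup (E ⊗[ℂ] F))

noncomputable instance : Module ℂ (AlgProj E F) :=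
  inferInstanceAs (Module ℂ (E ⊗[ℂ] F))

/-- The elementary tensor `x ⊗ y`. -/
noncomputable def tmul (x : E) (y : F) : AlgProj E F := (x ⊗ₜ[ℂ] y : E ⊗[ℂ] F)

/-- The possible values `∑ ‖xᵢ‖ ‖yᵢ‖` over all finite representations `u = ∑ xᵢ ⊗ yᵢ`. -/
def costs (u : AlgProj E F) : Set ℝ :=
  {r | ∃ l : List (E × F), (l.map fun p => tmul p.1 p.2).sum = u ∧
    (l.map fun p => ‖p.1‖ * ‖p.2‖).sum = r}

/-- The projective norm `‖u‖ = inf { ∑ ‖xᵢ‖ ‖yᵢ‖ : u = ∑ xᵢ ⊗ yᵢ }`. -/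
noncomputable instance : Norm (AlgProj E F) := ⟨fun u => sInf (costs u)⟩

theorem norm_def (u : AlgProj E F) : ‖u‖ = sInf (costs u) := rfl

theorem costs_nonneg {u : AlgProj E F} {r : ℝ} (hr : r ∈ costs u) : 0 ≤ r := by
  obtain ⟨l, -, rfl⟩ := hr
  refine List.sum_nonneg fun x hx => ?_
  obtain ⟨p, -, rfl⟩ := List.mem_map.1 hx
  positivity

theorem costs_bddBelow (u : AlgProj E F) : BddBelow (costs u) :=
  ⟨0, fun _ hr => costs_nonneg hr⟩

theorem costs_add {u v : AlgProj E F} {r s : ℝ} (hr : r ∈ costs u) (hs : s ∈ costs v) :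
    r + s ∈ costs (u + v) := by
  obtain ⟨l, rfl, rfl⟩ := hr
  obtain ⟨m, rfl, rfl⟩ := hs
  exact ⟨l ++ m, by simp, by simp⟩

theorem costs_tmul (x : E) (y : F) : ‖x‖ * ‖y‖ ∈ costs (tmul x y) :=
  ⟨[(x, y)], by simp, by simp⟩

theorem costs_smul (c : ℂ) {u : AlgProj E F} {r : ℝ} (hr : r ∈ costs u) :
    ‖c‖ * r ∈ costs (c • u) := by
  obtain ⟨l, rfl, rfl⟩ := hr
  refine ⟨l.map fun p => (c • p.1, p.2), ?_, ?_⟩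
  · rw [List.smul_sum, List.map_map, List.map_map]
    rfl
  · rw [← List.sum_map_mul_left, List.map_map]
    congr 1
    refine List.map_congr_left fun p _ => ?_
    simp [norm_smul, mul_assoc]

theorem costs_nonempty (u : AlgProj E F) : (costs u).Nonempty := by
  induction u using TensorProduct.induction_on with
  | zero => exact ⟨0, [], rfl, rfl⟩
  | tmul x y => exact ⟨_, costs_tmul x y⟩
  | add u v hu hv =>
    obtain ⟨r, hr⟩ := hu
    obtain ⟨s, hs⟩ := hv
    exact ⟨_, costs_add hr hs⟩

theorem norm_nonneg' (u : AlgProj E F) : 0 ≤ ‖u‖ :=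
  Real.sInf_nonneg fun _ hr => costs_nonneg hr

theorem norm_tmul_le (x : E) (y : F) : ‖tmul x y‖ ≤ ‖x‖ * ‖y‖ :=
  csInf_le (costs_bddBelow _) (costs_tmul x y)

theorem norm_add_le' (u v : AlgProj E F) : ‖u + v‖ ≤ ‖u‖ + ‖v‖ := by
  refine le_of_forall_pos_le_add fun ε hε => ?_
  obtain ⟨r, hr, hr'⟩ := exists_lt_of_csInf_lt (costs_nonempty u)
    (show sInf (costs u) < ‖u‖ + ε / 2 by rw [norm_def]; linarith)
  obtain ⟨s, hs, hs'⟩ := exists_lt_of_csInf_lt (costs_nonempty v)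
    (show sInf (costs v) < ‖v‖ + ε / 2 by rw [norm_def]; linarith)
  have : ‖u + v‖ ≤ r + s := csInf_le (costs_bddBelow _) (costs_add hr hs)
  linarith

theorem norm_smul_le' (c : ℂ) (u : AlgProj E F) : ‖c • u‖ ≤ ‖c‖ * ‖u‖ := by
  refine le_of_forall_pos_le_add fun ε hε => ?_
  have hc : 0 < ‖c‖ + 1 := by positivity
  obtain ⟨r, hr, hr'⟩ := exists_lt_of_csInf_lt (costs_nonempty u)
    (show sInf (costs u) < ‖u‖ + ε / (‖c‖ + 1) by
      rw [norm_def]; linarith [div_pos hε hc])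
  have h1 : ‖c • u‖ ≤ ‖c‖ * r := csInf_le (costs_bddBelow _) (costs_smul c hr)
  have h2 : ‖c‖ * r ≤ ‖c‖ * (‖u‖ + ε / (‖c‖ + 1)) := by gcongr
  have h3 : ‖c‖ * (ε / (‖c‖ + 1)) ≤ ε := by
    rw [mul_div_assoc', div_le_iff₀ hc]
    nlinarith [norm_nonneg c]
  linarith

theorem norm_zero' : ‖(0 : AlgProj E F)‖ = 0 :=
  le_antisymm (csInf_le (costs_bddBelow _) ⟨[], rfl, rfl⟩) (norm_nonneg' _)

theorem norm_neg' (u : AlgProj E F) : ‖-u‖ = ‖u‖ := by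
  have key : ∀ v : AlgProj E F, ‖-v‖ ≤ ‖v‖ := fun v => by
    simpa using norm_smul_le' (-1) v
  exact le_antisymm (key u) (by simpa using key (-u))

/-- The projective seminorm as an additive group seminorm. -/
noncomputable def projSeminorm (E F : Type*) [SeminormedAddCommGroup E] [NormedSpace ℂ E]
    [SeminormedAddCommGroup F] [NormedSpace ℂ F] : AddGroupSeminorm (AlgProj E F) where
  toFun u := ‖u‖
  map_zero' := norm_zero'
  add_le' := norm_add_le'
  neg' := norm_neg'

noncomputable instance : SeminormedAddCommGroup (AlgProj E F) :=
  (projSeminorm E F).toSeminormedAddCommGroup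

noncomputable instance : NormedSpace ℂ (AlgProj E F) where
  norm_smul_le := norm_smul_le'

theorem norm_map_le {N : Type*} [SeminormedAddCommGroup N] (T : AlgProj E F →+ N) {C : ℝ}
    (hC : 0 ≤ C) (hT : ∀ x y, ‖T (tmul x y)‖ ≤ C * (‖x‖ * ‖y‖)) (u : AlgProj E F) :
    ‖T u‖ ≤ C * ‖u‖ := by
  have key : ∀ r ∈ costs u, ‖T u‖ ≤ C * r := by
    rintro r ⟨l, rfl, rfl⟩
    induction l with
    | nil => simp
    | cons p l ih =>
      simp only [List.map_cons, List.sum_cons, map_add, mul_add]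
      exact (norm_add_le _ _).trans (add_le_add (hT _ _) ih)
  rcases hC.eq_or_lt with rfl | hC'
  · obtain ⟨r, hr⟩ := costs_nonempty u
    simpa using key r hr
  · rw [← div_le_iff₀' hC']
    exact le_csInf (costs_nonempty u) fun r hr => (div_le_iff₀' hC').2 (key r hr)

end Space

section Ring

variable {E F : Type*}
  [NonUnitalNormedRing E] [NormedSpace ℂ E] [IsScalarTower ℂ E E] [SMulCommClass ℂ E E]
  [NonUnitalNormedRing F] [NormedSpace ℂ F] [IsScalarTower ℂ F F] [SMulCommClass ℂ F F]

/-- The algebraic tensor product of algebras, `(x ⊗ y) (x' ⊗ y') = x x' ⊗ y y'`. -/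
noncomputable instance : NonUnitalRing (AlgProj E F) :=
  inferInstanceAs (NonUnitalRing (E ⊗[ℂ] F))

instance : IsScalarTower ℂ (AlgProj E F) (AlgProj E F) :=
  inferInstanceAs (IsScalarTower ℂ (E ⊗[ℂ] F) (E ⊗[ℂ] F))

instance : SMulCommClass ℂ (AlgProj E F) (AlgProj E F) :=
  inferInstanceAs (SMulCommClass ℂ (E ⊗[ℂ] F) (E ⊗[ℂ] F))

theorem tmul_mul_tmul (x x' : E) (y y' : F) :
    tmul x y * tmul x' y' = tmul (x * x') (y * y') :=
  Algebra.TensorProduct.tmul_mul_tmul x x' y y'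

theorem norm_mul_le' (u v : AlgProj E F) : ‖u * v‖ ≤ ‖u‖ * ‖v‖ := by
  rw [mul_comm ‖u‖]
  refine norm_map_le (AddMonoidHom.mulRight v) (norm_nonneg v) (fun x y => ?_) u
  refine (norm_map_le (AddMonoidHom.mulLeft (tmul x y)) (C := ‖x‖ * ‖y‖) (by positivity)
    (fun x' y' => ?_) v).trans_eq (mul_comm _ _)
  change ‖tmul x y * tmul x' y'‖ ≤ _
  rw [tmul_mul_tmul]
  calc _ ≤ ‖x * x'‖ * ‖y * y'‖ := norm_tmul_le _ _
    _ ≤ (‖x‖ * ‖x'‖) * (‖y‖ * ‖y'‖) := by gcongr <;> exact norm_mul_le _ _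
    _ = _ := by ring

noncomputable instance : NonUnitalSeminormedRing (AlgProj E F) :=
  { (inferInstance : SeminormedAddCommGroup (AlgProj E F)),
    (inferInstance : NonUnitalRing (AlgProj E F)) with
    norm_mul_le := norm_mul_le' }

end Ring

end AlgProj

/-- The Banach space projective tensor product: the completion of the algebraic tensor product
in the projective norm. -/
abbrev ProjTensor (E F : Type*) [SeminormedAddCommGroup E] [NormedSpace ℂ E]
    [SeminormedAddCommGroup F] [NormedSpace ℂ F] : Type _ :=
  UniformSpace.Completion (AlgProj E F)

namespace ProjTensor

/-- The elementary tensor `x ⊗ y` in the projective tensor product. -/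
noncomputable def tmul {E F : Type*} [SeminormedAddCommGroup E] [NormedSpace ℂ E]
    [SeminormedAddCommGroup F] [NormedSpace ℂ F] (x : E) (y : F) : ProjTensor E F :=
  ((AlgProj.tmul x y : AlgProj E F) : UniformSpace.Completion (AlgProj E F))

variable {E F : Type*}
  [NonUnitalNormedRing E] [NormedSpace ℂ E] [IsScalarTower ℂ E E] [SMulCommClass ℂ E E]
  [NonUnitalNormedRing F] [NormedSpace ℂ F] [IsScalarTower ℂ F F] [SMulCommClass ℂ F F]

open UniformSpace UniformSpace.Completion

/-- The product of the projective tensor product of two Banach algebras is the continuous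
extension of the product of the algebraic tensor product. -/
noncomputable instance : Mul (ProjTensor E F) :=
  ⟨Function.curry <| (isDenseInducing_coe.prodMap isDenseInducing_coe).extend
    (((↑) : AlgProj E F → Completion (AlgProj E F)) ∘ Function.uncurry (· * ·))⟩

theorem coe_mul (a b : AlgProj E F) :
    ((a * b : AlgProj E F) : ProjTensor E F) = (a : ProjTensor E F) * (b : ProjTensor E F) :=
  ((isDenseInducing_coe.prodMap isDenseInducing_coe).extend_eq
    ((continuous_coe (AlgProj E F)).comp (@continuous_mul (AlgProj E F) _ _ _)) (a, b)).symm

instance : ContinuousMul (ProjTensor E F) where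
  continuous_mul := by
    let m := (AddMonoidHom.mul : AlgProj E F →+ AlgProj E F →+ AlgProj E F).compr₂ toCompl
    have : Continuous fun p : AlgProj E F × AlgProj E F => m p.1 p.2 :=
      (continuous_coe (AlgProj E F)).comp continuous_mul
    have di : IsDenseInducing (toCompl : AlgProj E F → Completion (AlgProj E F)) :=
      isDenseInducing_coe
    exact (di.extend_Z_bilin di this :)

noncomputable instance : NonUnitalNormedRing (ProjTensor E F) :=
  { (inferInstance : NormedAddCommGroup (ProjTensor E F)),
    (inferInstance : Mul (ProjTensor E F)) with
    zero_mul a :=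
      Completion.induction_on a (isClosed_eq (by fun_prop) continuous_const)
        fun a => by rw [← coe_zero, ← coe_mul, zero_mul]
    mul_zero a :=
      Completion.induction_on a (isClosed_eq (by fun_prop) continuous_const)
        fun a => by rw [← coe_zero, ← coe_mul, mul_zero]
    mul_assoc a b c :=
      Completion.induction_on₃ a b c (isClosed_eq (by fun_prop) (by fun_prop))
        fun a b c => by rw [← coe_mul, ← coe_mul, ← coe_mul, ← coe_mul, mul_assoc]
    left_distrib a b c :=
      Completion.induction_on₃ a b c (isClosed_eq (by fun_prop) (by fun_prop))
        fun a b c => by rw [← coe_add, ← coe_mul, ← coe_mul, ← coe_mul, ← coe_add, mul_add]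
    right_distrib a b c :=
      Completion.induction_on₃ a b c (isClosed_eq (by fun_prop) (by fun_prop))
        fun a b c => by rw [← coe_add, ← coe_mul, ← coe_mul, ← coe_mul, ← coe_add, add_mul]
    norm_mul_le a b :=
      Completion.induction_on₂ a b (isClosed_le (by fun_prop) (by fun_prop))
        fun a b => by simpa only [← coe_mul, norm_coe] using norm_mul_le a b }

instance : IsScalarTower ℂ (ProjTensor E F) (ProjTensor E F) where
  smul_assoc c a b :=
    Completion.induction_on₂ a b
      (isClosed_eq ((continuous_fst.const_smul c).mul continuous_snd)
        ((continuous_fst.mul continuous_snd).const_smul c))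
      fun a b => by
        change (c • (a : ProjTensor E F)) * b = c • ((a : ProjTensor E F) * b)
        rw [← Completion.coe_smul, ← coe_mul, ← coe_mul, ← Completion.coe_smul, smul_mul_assoc]

instance : SMulCommClass ℂ (ProjTensor E F) (ProjTensor E F) where
  smul_comm c a b :=
    Completion.induction_on₂ a b
      (isClosed_eq ((continuous_fst.mul continuous_snd).const_smul c)
        (continuous_fst.mul (continuous_snd.const_smul c)))
      fun a b => by
        change c • ((a : ProjTensor E F) * b) = (a : ProjTensor E F) * (c • (b : ProjTensor E F))
        rw [← Completion.coe_smul, ← coe_mul, ← coe_mul, ← Completion.coe_smul, mul_smul_comm]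

theorem tmul_mul_tmul (x x' : E) (y y' : F) :
    tmul x y * tmul x' y' = (tmul (x * x') (y * y') : ProjTensor E F) := by
  rw [tmul, tmul, ← coe_mul, AlgProj.tmul_mul_tmul, tmul]

end ProjTensor

/-! ### The generalized group algebra `L¹(G, A)` -/

namespace GroupAlg


variable {G : Type*} [Group G] [TopologicalSpace G] [IsTopologicalGroup G]
  [LocallyCompactSpace G] [MeasurableSpace G] [BorelSpace G]
  {μ : Measure G} [μ.IsHaarMeasure] [μ.Regular]
  {A : Type*} [NonUnitalNormedRing A] [NormedSpace ℂ A] [IsScalarTower ℂ A A]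
  [SMulCommClass ℂ A A]

/-- Left translation `(y · g)(x) = g (y⁻¹ x)` on `L¹(G, A)`. -/
noncomputable def translate (y : G) : Lp A 1 μ →L[ℂ] Lp A 1 μ :=
  LinearMap.mkContinuous
    { toFun := fun g => DomMulAct.mk y⁻¹ • g
      map_add' := fun g h => smul_add _ g h
      map_smul' := fun c g => smul_comm _ c g } 1
    (fun g => by simp)

theorem translate_apply (y : G) (g : Lp A 1 μ) : translate y g = DomMulAct.mk y⁻¹ • g := rfl

theorem translate_ae (y : G) (g : Lp A 1 μ) : translate y g =ᵐ[μ] fun x => g (y⁻¹ * x) :=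
  DomMulAct.smul_Lp_ae_eq _ g

theorem norm_translate (y : G) (g : Lp A 1 μ) : ‖translate y g‖ = ‖g‖ :=
  DomMulAct.norm_smul_Lp _ _

theorem translate_mul (y z : G) (g : Lp A 1 μ) :
    translate (y * z) g = translate y (translate z g) := by
  rw [translate_apply, translate_apply, translate_apply, smul_smul, mul_inv_rev]
  rfl

theorem continuous_translate (g : Lp A 1 μ) : Continuous fun y : G => translate y g := by
  have : Fact ((1 : ℝ≥0∞) ≠ ∞) := ⟨ENNReal.one_ne_top⟩
  have h : Continuous fun y : G => DomMulAct.mk y⁻¹ :=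
    DomMulAct.continuous_mk.comp continuous_inv
  exact h.smul continuous_const

variable (μ A) in
/-- Pointwise left multiplication `(a g)(x) = a (g x)` on `L¹(G, A)`, as a continuous bilinear
map. -/
noncomputable def leftMul : A →L[ℂ] Lp A 1 μ →L[ℂ] Lp A 1 μ :=
  (ContinuousLinearMap.mul ℂ A).compLpL₂ 1 μ

theorem leftMul_ae (a : A) (g : Lp A 1 μ) : leftMul μ A a g =ᵐ[μ] fun x => a * g x :=
  (ContinuousLinearMap.mul ℂ A a).coeFn_compLp g

theorem norm_leftMul_le (a : A) (g : Lp A 1 μ) : ‖leftMul μ A a g‖ ≤ ‖a‖ * ‖g‖ := by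
  refine ((leftMul μ A).le_opNorm₂ a g).trans ?_
  have h : ‖leftMul μ A‖ ≤ 1 :=
    (ContinuousLinearMap.norm_compLpL₂_le _).trans (ContinuousLinearMap.opNorm_mul_le ℂ A)
  calc _ ≤ 1 * ‖a‖ * ‖g‖ := by gcongr
    _ = _ := by rw [one_mul]

theorem leftMul_mul (a b : A) (g : Lp A 1 μ) :
    leftMul μ A (a * b) g = leftMul μ A a (leftMul μ A b g) := by
  apply Lp.ext
  filter_upwards [leftMul_ae (μ := μ) (a * b) g, leftMul_ae a (leftMul μ A b g),
    leftMul_ae b g] with x h1 h2 h3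
  rw [h1, h2, h3, mul_assoc]

theorem translate_leftMul (y : G) (a : A) (g : Lp A 1 μ) :
    translate y (leftMul μ A a g) = leftMul μ A a (translate y g) := by
  apply Lp.ext
  have h := (measurePreserving_mul_left μ y⁻¹).quasiMeasurePreserving.ae_eq_comp
    (leftMul_ae (μ := μ) a g)
  filter_upwards [translate_ae y (leftMul μ A a g), leftMul_ae a (translate y g),
    translate_ae y g, h] with x h1 h2 h3 h4
  rw [h1, h2, h3]
  exact h4

/-- Convolution `f * g = ∫ f(y) (y · g) dy` on `L¹(G, A)`, as a Bochner integral in `L¹(G, A)`;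
pointwise, `(f * g)(x) = ∫ f(y) g(y⁻¹ x) dy = ∫ f(x y) g(y⁻¹) dy`
(see `conv_ae_eq` below, on the dense subspace of continuous functions with compact support). -/
noncomputable def conv (f g : Lp A 1 μ) : Lp A 1 μ :=
  ∫ y, leftMul μ A (f y) (translate y g) ∂μ

theorem aestronglyMeasurable_restrict {B : Type*} [NormedAddCommGroup B] {ψ : G → B}
    (hψ : Continuous ψ) {s : Set G} (hs : MeasurableSet s) (hμs : μ s < ∞) :
    AEStronglyMeasurable ψ (μ.restrict s) := by
  have hε : ∀ n : ℕ, ((n : ℝ≥0∞) + 1)⁻¹ ≠ 0 := fun n => by simp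
  choose K hK1 hK2 hK3 hK4 using fun n : ℕ =>
    hs.exists_isCompact_isClosed_sdiff_lt (μ := μ) hμs.ne (hε n)
  have h0 : μ (s \ ⋃ n, K n) = 0 := by
    refine le_antisymm (ENNReal.le_of_forall_pos_le_add fun ε hε' _ => ?_) zero_le
    obtain ⟨n, hn⟩ := ENNReal.exists_inv_nat_lt (ENNReal.coe_ne_zero.2 hε'.ne')
    rw [zero_add]
    calc μ (s \ ⋃ n, K n) ≤ μ (s \ K n) :=
          measure_mono (Set.sdiff_subset_sdiff_right (Set.subset_iUnion K n))
      _ ≤ ((n : ℝ≥0∞) + 1)⁻¹ := (hK4 n).le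
      _ ≤ (n : ℝ≥0∞)⁻¹ := ENNReal.inv_le_inv.2 le_self_add
      _ ≤ ε := hn.le
  have he : (s : Set G) =ᵐ[μ] ⋃ n, K n :=
    Filter.EventuallyLE.antisymm (ae_le_set.2 h0) (Set.iUnion_subset hK1).eventuallyLE
  rw [Measure.restrict_congr_set he]
  exact aestronglyMeasurable_iUnion_iff.2 fun n =>
    hψ.continuousOn.aestronglyMeasurable_of_isCompact (hK2 n) (hK3 n).measurableSet

theorem aestronglyMeasurable_conv {f : G → A} (hf : Integrable f μ) (g : Lp A 1 μ) :
    AEStronglyMeasurable (fun y => leftMul μ A (f y) (translate y g)) μ := by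
  refine Integrable.induction
    (fun f : G → A => AEStronglyMeasurable (fun y => leftMul μ A (f y) (translate y g)) μ)
    ?_ ?_ ?_ ?_ hf
  · intro c s hs hμs
    have h : (fun y => leftMul μ A (s.indicator (fun _ => c) y) (translate y g)) =
        s.indicator fun y => leftMul μ A c (translate y g) := by
      ext1 y
      by_cases hy : y ∈ s <;> simp [hy]
    rw [h, aestronglyMeasurable_indicator_iff hs]
    exact aestronglyMeasurable_restrict
      ((leftMul μ A c).continuous.comp (continuous_translate g)) hs hμs
  · intro f g _ _ _ h1 h2
    refine (h1.add h2).congr (Eventually.of_forall fun y => ?_)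
    simp
  · refine IsSeqClosed.isClosed fun u v hu huv => ?_
    obtain ⟨ns, -, hns⟩ := (tendstoInMeasure_of_tendsto_Lp huv).exists_seq_tendsto_ae
    refine aestronglyMeasurable_of_tendsto_ae atTop (fun n => hu (ns n)) ?_
    filter_upwards [hns] with y hy
    exact (((leftMul μ A).flip (translate y g)).continuous.tendsto _).comp hy
  · intro f f' hff' _ h
    refine h.congr ?_
    filter_upwards [hff'] with y hy
    rw [hy]

theorem integrable_conv {f : G → A} (hf : Integrable f μ) (g : Lp A 1 μ) :
    Integrable (fun y => leftMul μ A (f y) (translate y g)) μ := by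
  have hmeas := aestronglyMeasurable_conv hf g
  refine (hf.norm.mul_const ‖g‖).mono' hmeas (Eventually.of_forall fun y => ?_)
  simpa [norm_translate] using norm_leftMul_le (μ := μ) (f y) (translate y g)

theorem integrable_conv' (f g : Lp A 1 μ) :
    Integrable (fun y => leftMul μ A (f y) (translate y g)) μ :=
  integrable_conv (L1.integrable_coeFn f) g

theorem norm_conv_le (f g : Lp A 1 μ) : ‖conv f g‖ ≤ ‖f‖ * ‖g‖ := by
  rw [L1.norm_eq_integral_norm f, ← integral_mul_const]
  refine norm_integral_le_of_norm_le ((L1.integrable_coeFn f).norm.mul_const ‖g‖)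
    (Eventually.of_forall fun y => ?_)
  simpa [norm_translate] using norm_leftMul_le (μ := μ) (f y) (translate y g)

theorem conv_add (f g h : Lp A 1 μ) : conv f (g + h) = conv f g + conv f h := by
  rw [conv, conv, conv, ← integral_add (integrable_conv' f g) (integrable_conv' f h)]
  simp only [map_add]

theorem add_conv (f g h : Lp A 1 μ) : conv (f + g) h = conv f h + conv g h := by
  rw [conv, conv, conv, ← integral_add (integrable_conv' f h) (integrable_conv' g h)]
  refine integral_congr_ae ?_
  filter_upwards [Lp.coeFn_add f g] with y hy
  rw [hy, Pi.add_apply, map_add, add_apply]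

theorem conv_smul (c : ℂ) (f g : Lp A 1 μ) : conv f (c • g) = c • conv f g := by
  rw [conv, conv, ← integral_smul]
  simp only [map_smul]

theorem smul_conv (c : ℂ) (f g : Lp A 1 μ) : conv (c • f) g = c • conv f g := by
  rw [conv, conv, ← integral_smul]
  refine integral_congr_ae ?_
  filter_upwards [Lp.coeFn_smul c f] with y hy
  rw [hy, Pi.smul_apply, map_smul, smul_apply]

/-- Convolution as a continuous bilinear map. -/
noncomputable def convL : Lp A 1 μ →L[ℂ] Lp A 1 μ →L[ℂ] Lp A 1 μ :=
  LinearMap.mkContinuous₂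
    (LinearMap.mk₂ ℂ conv add_conv smul_conv conv_add conv_smul) 1
    (fun f g => by simpa using norm_conv_le f g)

theorem convL_apply (f g : Lp A 1 μ) : convL f g = conv f g := rfl

variable [CompleteSpace A]

theorem leftMul_conv (a : A) (u h : Lp A 1 μ) :
    conv (leftMul μ A a u) h = leftMul μ A a (conv u h) := by
  rw [conv, conv, ← (leftMul μ A a).integral_comp_comm (integrable_conv' u h)]
  refine integral_congr_ae ?_
  filter_upwards [leftMul_ae a u] with y hy
  rw [hy, leftMul_mul]

theorem translate_conv (y : G) (u h : Lp A 1 μ) :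
    conv (translate y u) h = translate y (conv u h) := by
  rw [conv, conv, ← (translate y).integral_comp_comm (integrable_conv' u h),
    ← integral_mul_left_eq_self (fun x => translate y (leftMul μ A (u x) (translate x h))) y⁻¹]
  refine integral_congr_ae ?_
  filter_upwards [translate_ae y u] with x hx
  rw [hx, translate_leftMul, ← translate_mul, mul_inv_cancel_left]

theorem conv_assoc (f g h : Lp A 1 μ) : conv (conv f g) h = conv f (conv g h) := by
  have key := (convL.flip h).integral_comp_comm (integrable_conv' f g)
  simp only [ContinuousLinearMap.flip_apply, convL_apply] at key
  rw [← conv] at key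
  rw [← key, conv]
  simp only [leftMul_conv, translate_conv]

end GroupAlg

/-- The generalized group algebra `L¹(G, A)`: (classes of) Bochner integrable functions `G → A`
with respect to the Haar measure `μ`, with the norm `∫ ‖f(x)‖ dx` and convolution as product. -/
def GroupAlg {G : Type*} [MeasurableSpace G] (μ : Measure G) (A : Type*)
    [NonUnitalNormedRing A] : Type _ := Lp A 1 μ

namespace GroupAlg


/-- The underlying element of `Lp A 1 μ`. -/
def toLp {G : Type*} [MeasurableSpace G] {μ : Measure G} {A : Type*} [NonUnitalNormedRing A]
    (f : GroupAlg μ A) : Lp A 1 μ := f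

variable {G : Type*} [Group G] [TopologicalSpace G] [IsTopologicalGroup G]
  [LocallyCompactSpace G] [MeasurableSpace G] [BorelSpace G]
  {μ : Measure G} [μ.IsHaarMeasure] [μ.Regular]
  {A : Type*} [NonUnitalNormedRing A] [NormedSpace ℂ A] [IsScalarTower ℂ A A]
  [SMulCommClass ℂ A A] [CompleteSpace A]

/-- `L¹(G, A)` with convolution and the `L¹`-norm is a Banach algebra. -/
noncomputable instance : NonUnitalNormedRing (GroupAlg μ A) :=
  { (inferInstance : NormedAddCommGroup (Lp A 1 μ)) with
    mul := conv
    left_distrib := conv_add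
    right_distrib := add_conv
    zero_mul := fun g => convL.map_zero₂ g
    mul_zero := fun f => (convL f).map_zero
    mul_assoc := conv_assoc
    norm_mul_le := norm_conv_le }

noncomputable instance : NormedSpace ℂ (GroupAlg μ A) :=
  { (inferInstance : Module ℂ (Lp A 1 μ)) with
    norm_smul_le := fun c (f : Lp A 1 μ) => norm_smul_le c f }

instance : CompleteSpace (GroupAlg μ A) := inferInstanceAs (CompleteSpace (Lp A 1 μ))

instance : IsScalarTower ℂ (GroupAlg μ A) (GroupAlg μ A) := ⟨fun c f g => smul_conv c f g⟩

instance : SMulCommClass ℂ (GroupAlg μ A) (GroupAlg μ A) :=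
  ⟨fun c f g => (conv_smul c f g).symm⟩

theorem mul_def (f g : GroupAlg μ A) : toLp (f * g) = conv (toLp f) (toLp g) := rfl

theorem norm_eq (f : GroupAlg μ A) : ‖f‖ = ∫ x, ‖f.toLp x‖ ∂μ :=
  L1.norm_eq_integral_norm (toLp f)

/-- On continuous functions with compact support the product of `L¹(G, A)` is the pointwise
convolution. -/
theorem conv_ae_eq {f g : G → A} (hf : Continuous f) (hcf : HasCompactSupport f)
    (hg : Continuous g) (hcg : HasCompactSupport g) (F H : GroupAlg μ A) (hF : ⇑F.toLp =ᵐ[μ] f)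
    (hH : ⇑H.toLp =ᵐ[μ] g) :
    ⇑(F * H).toLp =ᵐ[μ] fun x => ∫ y, f (x * y) * g y⁻¹ ∂μ := by
  have hpt : ∀ x, ∫ y, f (x * y) * g y⁻¹ ∂μ = ∫ y, f y * g (y⁻¹ * x) ∂μ := fun x => by
    rw [← integral_mul_left_eq_self (fun y => f y * g (y⁻¹ * x)) x]
    simp
  simp only [hpt]
  have hk : Continuous (Function.uncurry fun y x : G => f y * g (y⁻¹ * x)) := by
    unfold Function.uncurry
    fun_prop
  have hks : HasCompactSupport (Function.uncurry fun y x : G => f y * g (y⁻¹ * x)) := by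
    refine HasCompactSupport.intro' (K := (fun p : G × G => (p.1, p.1 * p.2)) ''
      (tsupport f ×ˢ tsupport g)) ((hcf.isCompact.prod hcg.isCompact).image (by fun_prop)) ?_ ?_
    · have e : (fun p : G × G => (p.1, p.1 * p.2)) '' (tsupport f ×ˢ tsupport g) =
          (fun p : G × G => (p.1, p.1⁻¹ * p.2)) ⁻¹' (tsupport f ×ˢ tsupport g) := by
        ext ⟨a, b⟩
        constructor
        · rintro ⟨⟨c, d⟩, hcd, h⟩
          simp only [Prod.mk.injEq] at h
          obtain ⟨rfl, rfl⟩ := h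
          simpa using hcd
        · intro h
          exact ⟨(a, a⁻¹ * b), h, by simp⟩
      rw [e]
      exact ((isClosed_tsupport f).prod (isClosed_tsupport g)).preimage (by fun_prop)
    · rintro ⟨a, b⟩ hab
      by_contra hne
      refine hab ⟨(a, a⁻¹ * b), ⟨subset_tsupport _ fun h => hne ?_,
        subset_tsupport _ fun h => hne ?_⟩, by simp⟩
      · simp [Function.uncurry, h]
      · simp only [] at h
        simp [Function.uncurry, h]
  have hv : Integrable (fun x => ∫ y, f y * g (y⁻¹ * x) ∂μ) μ := by
    refine Continuous.integrable_of_hasCompactSupport ?_ ?_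
    · have h : ContinuousOn (fun x => ∫ y, f y * g (y⁻¹ * x) ∂μ) Set.univ := by
        refine continuousOn_integral_of_compact_support hcf.isCompact ?_ ?_
        · exact Continuous.continuousOn (by unfold Function.uncurry; fun_prop)
        · intro p x _ hx
          rw [image_eq_zero_of_notMem_tsupport hx, zero_mul]
      exact continuousOn_univ.1 h
    · refine HasCompactSupport.intro (hks.isCompact.image continuous_snd) fun x hx => ?_
      refine integral_eq_zero_of_ae (Eventually.of_forall fun y => ?_)
      by_contra hy
      exact hx ⟨(y, x), subset_tsupport _ hy, rfl⟩
  refine Integrable.ae_eq_of_forall_setIntegral_eq _ _ (L1.integrable_coeFn _) hv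
    fun S hS hμS => ?_
  let J : Lp A 1 μ →L[ℂ] A := LinearMap.mkContinuous
    { toFun := fun u => ∫ x in S, u x ∂μ
      map_add' := fun u v => by
        rw [← integral_add (L1.integrable_coeFn u).integrableOn
          (L1.integrable_coeFn v).integrableOn]
        exact integral_congr_ae (ae_restrict_of_ae (Lp.coeFn_add u v))
      map_smul' := fun c u => by
        rw [RingHom.id_apply, ← integral_smul]
        exact integral_congr_ae (ae_restrict_of_ae (Lp.coeFn_smul c u)) } 1
    (fun u => by
      rw [one_mul, L1.norm_eq_integral_norm]
      exact (norm_integral_le_integral_norm _).trans (setIntegral_le_integral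
        (L1.integrable_coeFn u).norm (Eventually.of_forall fun _ => norm_nonneg _)))
  have hJ : ∀ u : Lp A 1 μ, J u = ∫ x in S, u x ∂μ := fun _ => rfl
  rw [← hJ, mul_def, conv, ← J.integral_comp_comm (integrable_conv' F.toLp H.toLp),
    ← integral_integral_swap_of_hasCompactSupport hk hks]
  refine integral_congr_ae ?_
  filter_upwards [hF] with y hy
  rw [hJ]
  refine integral_congr_ae (ae_restrict_of_ae ?_)
  have h := (measurePreserving_mul_left μ y⁻¹).quasiMeasurePreserving.ae_eq_comp hH
  filter_upwards [leftMul_ae (F.toLp y) (translate y H.toLp),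
    translate_ae y H.toLp, h] with x h1 h2 h3
  rw [h1, h2, hy]
  exact congrArg _ h3

end GroupAlg

/-! ### The hypotheses -/

/-- `G` is an [IN] group: the identity has a compact neighbourhood that is invariant under all
inner automorphisms. -/
def IsINGroup (G : Type*) [Group G] [TopologicalSpace G] : Prop :=
  ∃ K : Set G, IsCompact K ∧ K ∈ 𝓝 (1 : G) ∧ ∀ y : G, (fun x => y * x * y⁻¹) '' K = K

/-- The net `a` is a bounded `Z(A)`-approximate identity of `A`: it is norm-bounded and
`a i * z → z` for every `z` in the centre of `A`. -/
def IsBoundedCenterApproxIdentity {A ι : Type*} [NonUnitalNormedRing A] [Preorder ι]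
    (a : ι → A) : Prop :=
  (∃ M : ℝ, ∀ i, ‖a i‖ ≤ M) ∧
    ∀ z ∈ Set.center A, Tendsto (fun i => a i * z) atTop (𝓝 z)

/-!
An [IN] group is unimodular, because an invariant compact neighbourhood of the identity has the same
measure as its right translates. For a unimodular group `G`, testing against the functions `1_K a`
shows that `f ∈ L¹(G, A)` is central if and only if `a f(y⁻¹ x) = f(x y⁻¹) a` for all `a` and `y`,
which means that `f` takes central values and is invariant under inner automorphisms as soon as no
central `z ≠ 0` satisfies `A z = 0`. The sets which are conjugation invariant up to null sets form a
`σ`-algebra, so `Z(L¹(G, A))` is the space `L¹(ν, Z(A))` for the restriction `ν` of Haar measure to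
this `σ`-algebra. In particular `Z(L¹(G)) = L¹(ν)`, and the theorem becomes Grothendieck's
isomorphism `L¹(ν) ⊗^γ E ≃ L¹(ν, E)` for `E = Z(A)`.
-/

namespace AlgProj

variable {E F N : Type*} [SeminormedAddCommGroup E] [NormedSpace ℂ E]
  [SeminormedAddCommGroup F] [NormedSpace ℂ F] [SeminormedAddCommGroup N] [NormedSpace ℂ N]

theorem norm_tensorLift_le (B : E →L[ℂ] F →L[ℂ] N) (t : AlgProj E F) :
    ‖TensorProduct.lift B.toLinearMap₁₂ t‖ ≤ ‖B‖ * ‖t‖ :=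
  norm_map_le (TensorProduct.lift B.toLinearMap₁₂).toAddMonoidHom (norm_nonneg B)
    (fun x y => (B.le_opNorm₂ x y).trans_eq (mul_assoc _ _ _)) t

/-- The continuous linear map on the algebraic tensor product, with the projective norm, induced
by a continuous bilinear map. -/
noncomputable def lift (B : E →L[ℂ] F →L[ℂ] N) : AlgProj E F →L[ℂ] N :=
  LinearMap.mkContinuous (E := AlgProj E F) (TensorProduct.lift B.toLinearMap₁₂) ‖B‖
    (norm_tensorLift_le B)

end AlgProj

namespace ProjTensor

section Space

variable {E F E' F' N : Type*} [SeminormedAddCommGroup E] [NormedSpace ℂ E]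
  [SeminormedAddCommGroup F] [NormedSpace ℂ F] [SeminormedAddCommGroup E'] [NormedSpace ℂ E']
  [SeminormedAddCommGroup F'] [NormedSpace ℂ F'] [NormedAddCommGroup N] [NormedSpace ℂ N]

theorem norm_tmul_le (x : E) (y : F) : ‖tmul x y‖ ≤ ‖x‖ * ‖y‖ :=
  (UniformSpace.Completion.norm_coe _).trans_le (AlgProj.norm_tmul_le x y)

variable (E F) in
/-- The elementary tensor `x ⊗ y` as a continuous bilinear map. -/
noncomputable def tmulL : E →L[ℂ] F →L[ℂ] ProjTensor E F :=
  LinearMap.mkContinuous₂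
    ((TensorProduct.mk ℂ E F).compr₂
      (UniformSpace.Completion.toComplL : AlgProj E F →L[ℂ] ProjTensor E F).toLinearMap) 1
    fun x y => (norm_tmul_le x y).trans_eq (by rw [one_mul])

theorem tmulL_apply (x : E) (y : F) : tmulL E F x y = tmul x y := rfl

/-- The bilinear map `(x, y) ↦ e x ⊗ e' y` induced by isometries of the factors. -/
noncomputable def mapL (e : E ≃ₗᵢ[ℂ] E') (e' : F ≃ₗᵢ[ℂ] F') : E →L[ℂ] F →L[ℂ] ProjTensor E' F' :=
  (tmulL E' F').bilinearComp (e : E →L[ℂ] E') (e' : F →L[ℂ] F')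

theorem mapL_apply (e : E ≃ₗᵢ[ℂ] E') (e' : F ≃ₗᵢ[ℂ] F') (x : E) (y : F) :
    mapL e e' x y = tmul (e x) (e' y) := rfl

theorem norm_mapL_le (e : E ≃ₗᵢ[ℂ] E') (e' : F ≃ₗᵢ[ℂ] F') : ‖mapL e e'‖ ≤ 1 :=
  ContinuousLinearMap.opNorm_le_bound₂ _ zero_le_one fun x y =>
    (norm_tmul_le _ _).trans_eq (by rw [one_mul]; exact congrArg₂ _ (e.norm_map x) (e'.norm_map y))

theorem induction_on {p : ProjTensor E F → Prop} (u : ProjTensor E F) (hp : IsClosed {u | p u})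
    (tmul : ∀ x y, p (tmul x y)) (add : ∀ u v, p u → p v → p (u + v)) : p u := by
  refine UniformSpace.Completion.induction_on u hp fun t => ?_
  induction t using TensorProduct.induction_on with
  | zero => simpa only [ProjTensor.tmul, AlgProj.tmul, TensorProduct.zero_tmul] using tmul 0 0
  | tmul x y => exact tmul x y
  | add s t hs ht =>
    exact (UniformSpace.Completion.coe_add (α := AlgProj E F) s t).symm ▸ add _ _ hs ht

variable [CompleteSpace N]

/-- The continuous linear map on the projective tensor product induced by a continuous bilinear
map. -/
noncomputable def lift (B : E →L[ℂ] F →L[ℂ] N) : ProjTensor E F →L[ℂ] N :=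
  (AlgProj.lift B).fromCompletion

theorem lift_coe (B : E →L[ℂ] F →L[ℂ] N) (t : AlgProj E F) : lift B t = AlgProj.lift B t :=
  (AlgProj.lift B).fromCompletion_apply_coe t

theorem lift_tmul (B : E →L[ℂ] F →L[ℂ] N) (x : E) (y : F) : lift B (tmul x y) = B x y :=
  lift_coe B _

theorem norm_lift_apply_le (B : E →L[ℂ] F →L[ℂ] N) (u : ProjTensor E F) :
    ‖lift B u‖ ≤ ‖B‖ * ‖u‖ := by
  refine UniformSpace.Completion.induction_on u (isClosed_le (by fun_prop) (by fun_prop))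
    fun t => ?_
  rw [lift_coe]
  exact (AlgProj.norm_tensorLift_le B t).trans_eq
    (congrArg _ (UniformSpace.Completion.norm_coe t).symm)

/-- A contractive bilinear map whose lift has a contractive inverse identifies the projective
tensor product isometrically with its codomain. -/
noncomputable def liftEquiv (B : E →L[ℂ] F →L[ℂ] N) (hB : ‖B‖ ≤ 1) (Ψ : N →L[ℝ] ProjTensor E F)
    (hΨ : ‖Ψ‖ ≤ 1) (left_inv : ∀ x y, Ψ (B x y) = tmul x y)
    (right_inv : ∀ v, lift B (Ψ v) = v) : ProjTensor E F ≃ₗᵢ[ℂ] N :=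
  LinearIsometryEquiv.ofSurjective
    { toLinearMap := lift B
      norm_map' := fun u => by
        have hΨu : Ψ (lift B u) = u := by
          induction u using induction_on with
          | hp => exact isClosed_eq (by fun_prop) continuous_id
          | tmul x y => rw [lift_tmul, left_inv]
          | add u v hu hv => rw [map_add, map_add, hu, hv]
        refine le_antisymm ?_ ?_
        · exact (norm_lift_apply_le B u).trans (mul_le_of_le_one_left (norm_nonneg u) hB)
        · simpa [hΨu] using (Ψ.le_of_opNorm_le hΨ (lift B u)) }
    fun v => ⟨Ψ v, right_inv v⟩

theorem liftEquiv_tmul {B : E →L[ℂ] F →L[ℂ] N} {hB : ‖B‖ ≤ 1} {Ψ : N →L[ℝ] ProjTensor E F}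
    {hΨ : ‖Ψ‖ ≤ 1} {left_inv : ∀ x y, Ψ (B x y) = tmul x y}
    {right_inv : ∀ v, lift B (Ψ v) = v} (x : E) (y : F) :
    liftEquiv B hB Ψ hΨ left_inv right_inv (tmul x y) = B x y :=
  lift_tmul B x y

/-- Isometric isomorphisms of the factors induce one of the projective tensor products. -/
noncomputable def congr (e : E ≃ₗᵢ[ℂ] E') (e' : F ≃ₗᵢ[ℂ] F') :
    ProjTensor E F ≃ₗᵢ[ℂ] ProjTensor E' F' :=
  liftEquiv (mapL e e') (norm_mapL_le e e') ((lift (mapL e.symm e'.symm)).restrictScalars ℝ)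
    (ContinuousLinearMap.opNorm_le_bound _ zero_le_one fun u =>
      (norm_lift_apply_le _ u).trans
        (mul_le_mul_of_nonneg_right (norm_mapL_le _ _) (norm_nonneg u)))
    (fun x y => (lift_tmul _ _ _).trans (by simp [mapL_apply]))
    (fun v => by
      induction v using induction_on with
      | hp => exact isClosed_eq (by fun_prop) continuous_id
      | tmul x y => simp [lift_tmul, mapL_apply]
      | add u v hu hv => rw [map_add, map_add, hu, hv])

theorem congr_tmul (e : E ≃ₗᵢ[ℂ] E') (e' : F ≃ₗᵢ[ℂ] F') (x : E) (y : F) :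
    congr e e' (tmul x y) = tmul (e x) (e' y) :=
  liftEquiv_tmul x y

end Space

section Ring

variable {E F R : Type*}
  [NonUnitalNormedRing E] [NormedSpace ℂ E] [IsScalarTower ℂ E E] [SMulCommClass ℂ E E]
  [NonUnitalNormedRing F] [NormedSpace ℂ F] [IsScalarTower ℂ F F] [SMulCommClass ℂ F F]
  [NonUnitalNormedRing R] [NormedSpace ℂ R]

theorem map_mul_of_tmul (T : ProjTensor E F →L[ℂ] R)
    (hT : ∀ x y x' y', T (tmul (x * x') (y * y')) = T (tmul x y) * T (tmul x' y'))
    (u v : ProjTensor E F) : T (u * v) = T u * T v := by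
  induction u using induction_on with
  | hp => exact isClosed_eq (by fun_prop) (by fun_prop)
  | add u u' hu hu' => rw [add_mul, map_add, hu, hu', map_add, add_mul]
  | tmul x y =>
    induction v using induction_on with
    | hp => exact isClosed_eq (by fun_prop) (by fun_prop)
    | add v v' hv hv' => rw [mul_add, map_add, hv, hv', map_add, mul_add]
    | tmul x' y' => rw [tmul_mul_tmul, hT]

end Ring

end ProjTensor

section L1

variable {X : Type*} {mX : MeasurableSpace X} {ν : Measure X} {E N : Type*}
  [NormedAddCommGroup E] [NormedSpace ℂ E]

theorem clm_ext_indicatorConstLp [NormedAddCommGroup N] [NormedSpace ℝ N] {S T : Lp E 1 ν →L[ℝ] N}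
    (h : ∀ (c : E) {s : Set X} (hs : MeasurableSet s) (hνs : ν s ≠ ∞),
      S (indicatorConstLp 1 hs hνs c) = T (indicatorConstLp 1 hs hνs c)) : S = T := by
  ext f
  induction f using Lp.induction ENNReal.one_ne_top with
  | indicatorConst c hs hνs => exact h c hs hνs.ne
  | add hf hg _ hSf hSg => rw [map_add, map_add, hSf, hSg]
  | isClosed => exact isClosed_eq S.continuous T.continuous

theorem indicatorConstLp_smul {s : Set X} (hs : MeasurableSet s) (hνs : ν s ≠ ∞) (c : ℂ) (z : E) :
    indicatorConstLp 1 hs hνs (c • z) = c • indicatorConstLp 1 hs hνs z := by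
  simp only [indicatorConstLp, ← MemLp.toLp_const_smul, Set.indicator_const_smul]
  rfl

end L1

namespace ProjTensor

variable {X : Type*} {mX : MeasurableSpace X} {ν : Measure X} {E : Type*}
  [NormedAddCommGroup E] [NormedSpace ℂ E]

variable (ν E) in
/-- The bilinear map `(f, z) ↦ f(·) z` of `L¹(ν) × E` into `L¹(ν, E)`. -/
noncomputable def smulL : Lp ℂ 1 ν →L[ℂ] E →L[ℂ] Lp E 1 ν :=
  ((ContinuousLinearMap.lsmul ℂ ℂ).flip.compLpL₂ 1 ν).flip

theorem smulL_ae (f : Lp ℂ 1 ν) (z : E) : smulL ν E f z =ᵐ[ν] fun x => f x • z :=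
  ((ContinuousLinearMap.lsmul ℂ ℂ).flip z).coeFn_compLp f

theorem norm_smulL_le : ‖smulL ν E‖ ≤ 1 := by
  rw [smulL, ContinuousLinearMap.opNorm_flip]
  refine (ContinuousLinearMap.norm_compLpL₂_le _).trans ?_
  rw [ContinuousLinearMap.opNorm_flip]
  exact ContinuousLinearMap.opNorm_lsmul_le

theorem smulL_indicatorConstLp {s : Set X} (hs : MeasurableSet s) (hνs : ν s ≠ ∞) (c : ℂ) (z : E) :
    smulL ν E (indicatorConstLp 1 hs hνs c) z = indicatorConstLp 1 hs hνs (c • z) := by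
  apply Lp.ext
  refine (smulL_ae _ z).trans ?_
  filter_upwards [indicatorConstLp_coeFn (p := 1) (hs := hs) (hμs := hνs) (c := c),
    indicatorConstLp_coeFn (p := 1) (hs := hs) (hμs := hνs) (c := c • z)] with x hc hcz
  rw [hc, hcz]
  by_cases hx : x ∈ s <;> simp [hx]

open Classical in
variable (ν E) in
/-- The set function `s ↦ (z ↦ 1_s ⊗ z)`, extended by zero to the sets which are not measurable of
finite measure; it is the vector measure which integrates `v ∈ L¹(ν, E)` to a tensor. -/
noncomputable def indicatorTmul (s : Set X) : E →L[ℝ] ProjTensor (Lp ℂ 1 ν) E :=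
  if h : MeasurableSet s ∧ ν s ≠ ∞ then
    (tmulL (Lp ℂ 1 ν) E (indicatorConstLp 1 h.1 h.2 1)).restrictScalars ℝ
  else 0

theorem indicatorTmul_apply {s : Set X} (hs : MeasurableSet s) (hνs : ν s ≠ ∞) (z : E) :
    indicatorTmul ν E s z = tmul (indicatorConstLp 1 hs hνs (1 : ℂ)) z := by
  rw [indicatorTmul, dif_pos ⟨hs, hνs⟩]
  rfl

theorem dominatedFinMeasAdditive_indicatorTmul :
    DominatedFinMeasAdditive ν (indicatorTmul ν E) 1 := by
  refine ⟨fun s t hs ht hνs hνt hst => ?_, fun s hs hνs => ?_⟩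
  · ext z
    rw [add_apply, indicatorTmul_apply hs hνs, indicatorTmul_apply ht hνt,
      indicatorTmul_apply (hs.union ht) (measure_union_ne_top hνs hνt),
      indicatorConstLp_disjoint_union hs ht hνs hνt hst]
    exact (tmulL (Lp ℂ 1 ν) E).map_add₂ _ _ z
  · refine ContinuousLinearMap.opNorm_le_bound _ (by positivity) fun z => ?_
    rw [indicatorTmul_apply hs hνs.ne]
    exact (norm_tmul_le _ z).trans_eq (by simp [norm_indicatorConstLp])

variable (ν E) in
/-- The map `L¹(ν, E) → L¹(ν) ⊗^γ E` which sends `1_s z` to `1_s ⊗ z`. -/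
noncomputable def ofL1 : Lp E 1 ν →L[ℝ] ProjTensor (Lp ℂ 1 ν) E :=
  L1.setToL1 dominatedFinMeasAdditive_indicatorTmul

theorem norm_ofL1_le : ‖ofL1 ν E‖ ≤ 1 :=
  L1.norm_setToL1_le _ zero_le_one

theorem ofL1_indicatorConstLp {s : Set X} (hs : MeasurableSet s) (hνs : ν s ≠ ∞) (z : E) :
    ofL1 ν E (indicatorConstLp 1 hs hνs z) = tmul (indicatorConstLp 1 hs hνs (1 : ℂ)) z :=
  (L1.setToL1_indicatorConstLp _ hs hνs z).trans (indicatorTmul_apply hs hνs z)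

theorem ofL1_smulL (f : Lp ℂ 1 ν) (z : E) : ofL1 ν E (smulL ν E f z) = tmul f z := by
  suffices h : (ofL1 ν E).comp (((smulL ν E).flip z).restrictScalars ℝ) =
      ((tmulL (Lp ℂ 1 ν) E).flip z).restrictScalars ℝ from DFunLike.congr_fun h f
  refine clm_ext_indicatorConstLp fun c s hs hνs => ?_
  have hc : indicatorConstLp 1 hs hνs c = c • indicatorConstLp 1 hs hνs (1 : ℂ) := by
    rw [← indicatorConstLp_smul, smul_eq_mul, mul_one]
  change ofL1 ν E (smulL ν E _ z) = tmulL _ _ _ z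
  rw [smulL_indicatorConstLp, ofL1_indicatorConstLp, hc, (tmulL _ _).map_smul₂,
    ← map_smul, tmulL_apply]

variable [CompleteSpace E]

theorem lift_smulL_ofL1 (v : Lp E 1 ν) : lift (smulL ν E) (ofL1 ν E v) = v := by
  suffices h : ((lift (smulL ν E)).restrictScalars ℝ).comp (ofL1 ν E) = .id ℝ _ from
    DFunLike.congr_fun h v
  refine clm_ext_indicatorConstLp fun c s hs hνs => ?_
  change lift (smulL ν E) (ofL1 ν E _) = _
  rw [ofL1_indicatorConstLp, lift_tmul, smulL_indicatorConstLp, one_smul]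
  rfl

variable (ν E) in
/-- Grothendieck's identification `L¹(ν) ⊗^γ E ≅ L¹(ν, E)`. -/
noncomputable def l1Equiv : ProjTensor (Lp ℂ 1 ν) E ≃ₗᵢ[ℂ] Lp E 1 ν :=
  liftEquiv (smulL ν E) norm_smulL_le (ofL1 ν E) norm_ofL1_le ofL1_smulL lift_smulL_ofL1

theorem l1Equiv_tmul (f : Lp ℂ 1 ν) (z : E) : l1Equiv ν E (tmul f z) = smulL ν E f z :=
  liftEquiv_tmul f z

end ProjTensor

section Unimodular

variable {G : Type*} [Group G] [TopologicalSpace G] [IsTopologicalGroup G]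
  [LocallyCompactSpace G] [MeasurableSpace G] [BorelSpace G]
  (μ : Measure G) [μ.IsHaarMeasure] [μ.Regular]

variable {μ} in
theorem eq_of_isMulLeftInvariant_of_apply_eq {ν : Measure G} [ν.IsMulLeftInvariant] [ν.Regular]
    {K : Set G} (hK : IsCompact K) (hK₁ : K ∈ 𝓝 1) (h : ν K = μ K) : ν = μ := by
  have hν := Measure.isMulLeftInvariant_eq_smul_of_regular ν μ
  rw [hν, Measure.smul_apply, ENNReal.smul_def, smul_eq_mul,
    ENNReal.mul_eq_right (Measure.measure_pos_of_mem_nhds μ hK₁).ne' hK.measure_lt_top.ne,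
    ENNReal.coe_eq_one] at h
  rw [hν, h, one_smul]

theorem IsINGroup.isMulRightInvariant (hG : IsINGroup G) : μ.IsMulRightInvariant := by
  obtain ⟨K, hK, hK₁, hKconj⟩ := hG
  refine ⟨fun g => ?_⟩
  have : (μ.map (· * g)).Regular := Measure.Regular.map (Homeomorph.mulRight g)
  refine eq_of_isMulLeftInvariant_of_apply_eq hK hK₁ ?_
  have hpre : (g⁻¹ * ·) ⁻¹' ((· * g) ⁻¹' K) = K := by
    nth_rewrite 1 [← hKconj g⁻¹]
    ext x
    simp
  rw [← MeasurableEquiv.coe_mulRight g, MeasurableEquiv.map_apply, MeasurableEquiv.coe_mulRight,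
    ← measure_preimage_mul μ g⁻¹, hpre]

instance isInvInvariant_of_isMulRightInvariant [μ.IsMulRightInvariant] : μ.IsInvInvariant := by
  have : μ.inv.Regular := Measure.Regular.map (Homeomorph.inv G)
  obtain ⟨K, hK, hK₁⟩ := exists_compact_mem_nhds (1 : G)
  refine ⟨eq_of_isMulLeftInvariant_of_apply_eq (hK.union hK.inv) (mem_of_superset hK₁ (by simp)) ?_⟩
  rw [Measure.inv_apply, Set.union_inv, inv_inv, Set.union_comm]

end Unimodular

section CompactSupport

variable {X E : Type*} [TopologicalSpace X] [R1Space X] [WeaklyLocallyCompactSpace X]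
  [MeasurableSpace X] [BorelSpace X] {μ : Measure X} [μ.Regular]
  [NormedAddCommGroup E] [NormedSpace ℝ E] {p : ℝ≥0∞}

theorem exists_hasCompactSupport_eLpNorm_sub_indicator_le (hp : p ≠ ∞) (c : E) {S : Set X}
    (hS : MeasurableSet S) (hμS : μ S ≠ ∞) {ε : ℝ≥0∞} (hε : ε ≠ 0) :
    ∃ φ : X → E, eLpNorm (φ - S.indicator fun _ => c) p μ ≤ ε ∧ Continuous φ ∧
      HasCompactSupport φ := by
  obtain ⟨η, hη₀, hη⟩ := exists_eLpNorm_indicator_le (μ := μ) hp c hε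
  have hη₂ : (η / 2 : ℝ≥0∞) ≠ 0 := by simpa using hη₀.ne'
  obtain ⟨K, hKS, hK, -, hμK⟩ := hS.exists_isCompact_isClosed_sdiff_lt hμS hη₂
  obtain ⟨V, hSV, hV, -, hμV⟩ := hS.exists_isOpen_sdiff_lt hμS hη₂
  obtain ⟨g, hgK, hgV, hg_supp, hg⟩ := exists_continuous_one_zero_of_isCompact hK hV.isClosed_compl
    (Set.disjoint_compl_right_iff_subset.2 (hKS.trans hSV))
  have hμ : μ ((V \ S) ∪ (S \ K)) ≤ η := (measure_union_le _ _).trans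
    ((add_le_add hμV.le hμK.le).trans_eq (ENNReal.add_halves _))
  refine ⟨fun x => g x • c, (eLpNorm_mono fun x => ?_).trans (hη _ hμ), by fun_prop,
    hg_supp.smul_right⟩
  obtain ⟨hg₀, hg₁⟩ := hg x
  by_cases hxS : x ∈ S
  · by_cases hxK : x ∈ K
    · simp [hxS, hxK, hgK hxK]
    · have : ‖g x • c - c‖ ≤ ‖c‖ := by
        rw [norm_sub_rev, show c - g x • c = (1 - g x) • c by rw [sub_smul, one_smul], norm_smul,
          Real.norm_of_nonneg (by linarith)]
        exact mul_le_of_le_one_left (norm_nonneg c) (by linarith)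
      simpa [hxS, hxK]
  · by_cases hxV : x ∈ V
    · simpa [hxS, hxV, norm_smul, abs_of_nonneg hg₀] using
        mul_le_of_le_one_left (norm_nonneg c) hg₁
    · simp [hxS, hxV, show g x = 0 from hgV hxV]

theorem dense_setOf_ae_eq_hasCompactSupport [Fact (1 ≤ p)] (hp : p ≠ ∞) :
    Dense {f : Lp E p μ | ∃ φ : X → E, Continuous φ ∧ HasCompactSupport φ ∧ f =ᵐ[μ] φ} := by
  refine fun f => EMetric.mem_closure_iff.2 fun ε hε => ?_
  obtain ⟨δ, hδ, hδε⟩ := exists_between hε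
  obtain ⟨φ, hfφ, hφ, hφc⟩ := (Lp.memLp f).induction_dense hp
    (fun φ : X → E => Continuous φ ∧ HasCompactSupport φ)
    (fun c S hS hμS _ => exists_hasCompactSupport_eLpNorm_sub_indicator_le hp c hS hμS.ne)
    (fun φ ψ hφ hψ => ⟨hφ.1.add hψ.1, hφ.2.add hψ.2⟩)
    (fun φ hφ => (hφ.1.integrable_of_hasCompactSupport hφ.2).aestronglyMeasurable) hδ.ne'
  have hφ_mem : MemLp φ p μ := hφ.memLp_of_hasCompactSupport hφc
  refine ⟨hφ_mem.toLp φ, ⟨φ, hφ, hφc, hφ_mem.coeFn_toLp⟩, lt_of_le_of_lt ?_ hδε⟩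
  rwa [Lp.edist_def, eLpNorm_congr_ae (EventuallyEq.rfl.sub hφ_mem.coeFn_toLp)]

end CompactSupport

section CompLp

variable {X E F : Type*} {mX : MeasurableSpace X} {μ : Measure X}
  [NormedAddCommGroup E] [NormedSpace ℂ E] [NormedAddCommGroup F] [NormedSpace ℂ F]

/-- Post-composition with a linear isometry, as an isometry of `L¹` spaces. -/
noncomputable def compLpₗᵢ (j : E →ₗᵢ[ℂ] F) : Lp E 1 μ →ₗᵢ[ℂ] Lp F 1 μ where
  toLinearMap := j.toContinuousLinearMap.compLpₗ 1 μ
  norm_map' f := by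
    rw [Lp.norm_def, Lp.norm_def]
    refine congrArg _ (eLpNorm_congr_norm_ae ?_)
    filter_upwards [j.toContinuousLinearMap.coeFn_compLp f] with x hx
    exact (congrArg _ hx).trans (j.norm_map _)

theorem compLpₗᵢ_ae (j : E →ₗᵢ[ℂ] F) (f : Lp E 1 μ) : compLpₗᵢ j f =ᵐ[μ] fun x => j (f x) :=
  j.toContinuousLinearMap.coeFn_compLp f

end CompLp

namespace GroupAlg

section RightMul

variable {G : Type*} [MeasurableSpace G] {μ : Measure G}
  {A : Type*} [NonUnitalNormedRing A] [NormedSpace ℂ A] [IsScalarTower ℂ A A]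
  [SMulCommClass ℂ A A]

variable (μ A) in
/-- Pointwise right multiplication `(f a)(x) = f(x) a` on `L¹(G, A)`, as a continuous bilinear
map `(a, f) ↦ f a`. -/
noncomputable def rightMul : A →L[ℂ] Lp A 1 μ →L[ℂ] Lp A 1 μ :=
  (ContinuousLinearMap.mul ℂ A).flip.compLpL₂ 1 μ

theorem rightMul_ae (a : A) (f : Lp A 1 μ) : rightMul μ A a f =ᵐ[μ] fun x => f x * a :=
  ((ContinuousLinearMap.mul ℂ A).flip a).coeFn_compLp f

theorem setIntegral_rightMul [CompleteSpace A] (a : A) (f : Lp A 1 μ) (S : Set G) :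
    ∫ x in S, rightMul μ A a f x ∂μ = (∫ x in S, f x ∂μ) * a :=
  (integral_congr_ae (ae_restrict_of_ae (rightMul_ae a f))).trans
    (((ContinuousLinearMap.mul ℂ A).flip a).integral_comp_comm
      (L1.integrable_coeFn f).integrableOn)

end RightMul

section RightTranslate

variable {G : Type*} [Group G] [TopologicalSpace G] [IsTopologicalGroup G]
  [MeasurableSpace G] [BorelSpace G] {μ : Measure G} [μ.IsMulRightInvariant]
  {E : Type*} [NormedAddCommGroup E] [NormedSpace ℂ E]

/-- Right translation `(f · y)(x) = f (x y)` on `L¹(G, E)`. -/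
noncomputable def rightTranslate (y : G) : Lp E 1 μ →L[ℂ] Lp E 1 μ :=
  (Lp.compMeasurePreservingₗᵢ ℂ (· * y) (measurePreserving_mul_right μ y)).toContinuousLinearMap

theorem rightTranslate_ae (y : G) (f : Lp E 1 μ) :
    rightTranslate y f =ᵐ[μ] fun x => f (x * y) :=
  Lp.coeFn_compMeasurePreserving f (measurePreserving_mul_right μ y)

theorem continuous_rightTranslate [LocallyCompactSpace G] [μ.Regular] (f : Lp E 1 μ) :
    Continuous fun y : G => rightTranslate y f :=
  continuous_const.compMeasurePreservingLp
    (ContinuousMap.continuous_of_continuous_uncurry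
      (fun y => (⟨(· * y), continuous_mul_const y⟩ : C(G, G)))
      (continuous_snd.mul (continuous_fst (X := G) (Y := G))))
    (measurePreserving_mul_right μ) ENNReal.one_ne_top

end RightTranslate

section Reflect

variable {G : Type*} [Group G] [MeasurableSpace G] [MeasurableInv G]
  {μ : Measure G} [μ.IsInvInvariant]
  {E F : Type*} [NormedAddCommGroup E] [NormedSpace ℂ E] [NormedAddCommGroup F] [NormedSpace ℂ F]

/-- The isometry `f ↦ j (f (x⁻¹))`. With the anti-isomorphism `A → Aᵐᵒᵖ` as `j`, it exchanges left
and right. -/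
noncomputable def reflect (j : E →ₗᵢ[ℂ] F) : Lp E 1 μ →ₗᵢ[ℂ] Lp F 1 μ :=
  (Lp.compMeasurePreservingₗᵢ ℂ Inv.inv (Measure.measurePreserving_inv μ)).comp (compLpₗᵢ j)

theorem reflect_ae_of_ae_eq (j : E →ₗᵢ[ℂ] F) {f : Lp E 1 μ} {φ : G → E} (hf : f =ᵐ[μ] φ) :
    reflect j f =ᵐ[μ] fun x => j (φ x⁻¹) :=
  (Lp.coeFn_compMeasurePreserving _ (Measure.measurePreserving_inv μ)).trans
    ((Measure.measurePreserving_inv μ).quasiMeasurePreserving.ae_eq_comp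
      ((compLpₗᵢ_ae j f).trans (hf.fun_comp j)))

end Reflect

section RightConv

variable {G : Type*} [Group G] [TopologicalSpace G] [IsTopologicalGroup G]
  [LocallyCompactSpace G] [MeasurableSpace G] [BorelSpace G]
  {μ : Measure G} [μ.IsHaarMeasure] [μ.Regular]
  {A B : Type*} [NonUnitalNormedRing A] [NormedSpace ℂ A] [IsScalarTower ℂ A A]
  [SMulCommClass ℂ A A]

theorem continuous_conv : Continuous fun p : Lp A 1 μ × Lp A 1 μ => conv p.1 p.2 :=
  (convL (μ := μ) (A := A)).continuous₂

variable [μ.IsMulRightInvariant] [NonUnitalNormedRing B] [NormedSpace ℂ B] [IsScalarTower ℂ B B]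
  [SMulCommClass ℂ B B] {j : A →ₗᵢ[ℂ] B}

theorem reflect_rightMul_rightTranslate (hj : ∀ a b, j (a * b) = j b * j a) (a : A) (y : G)
    (f : Lp A 1 μ) :
    reflect j (rightMul μ A a (rightTranslate y f)) =
      leftMul μ B (j a) (translate y (reflect j f)) := by
  apply Lp.ext
  have h := (measurePreserving_mul_left μ y⁻¹).quasiMeasurePreserving.ae_eq_comp
    (reflect_ae_of_ae_eq j (EventuallyEq.refl _ f))
  filter_upwards [reflect_ae_of_ae_eq j ((rightMul_ae a _).trans
    ((rightTranslate_ae y f).fun_comp (· * a))), leftMul_ae (j a) (translate y (reflect j f)),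
    translate_ae y (reflect j f), h] with x h₁ h₂ h₃ h₄
  rw [h₁, h₂, h₃]
  simp only [Function.comp_apply] at h₄ ⊢
  rw [h₄, hj, mul_inv_rev, inv_inv]

variable [CompleteSpace A] [CompleteSpace B]

theorem reflect_conv_of_hasCompactSupport (hj : ∀ a b, j (a * b) = j b * j a) {f g : Lp A 1 μ}
    {φ ψ : G → A} (hφ : Continuous φ) (hφc : HasCompactSupport φ) (hf : f =ᵐ[μ] φ)
    (hψ : Continuous ψ) (hψc : HasCompactSupport ψ) (hg : g =ᵐ[μ] ψ) :
    reflect j (conv f g) = conv (reflect j g) (reflect j f) := by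
  have h₁ := reflect_ae_of_ae_eq j (conv_ae_eq (μ := μ) hφ hφc hψ hψc f g hf hg)
  have h₂ := conv_ae_eq (μ := μ) (j.continuous.comp (hψ.comp continuous_inv))
    ((hψc.comp_homeomorph (Homeomorph.inv G)).comp_left j.map_zero)
    (j.continuous.comp (hφ.comp continuous_inv))
    ((hφc.comp_homeomorph (Homeomorph.inv G)).comp_left j.map_zero)
    (reflect j g) (reflect j f) (reflect_ae_of_ae_eq j hg) (reflect_ae_of_ae_eq j hf)
  refine Lp.ext (h₁.trans (EventuallyEq.trans (Eventually.of_forall fun x => ?_) h₂.symm))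
  simp only [Function.comp_apply, inv_inv, mul_inv_rev]
  rw [← j.integral_comp_comm, ← integral_mul_left_eq_self _ x]
  simp [hj]

theorem reflect_conv (hj : ∀ a b, j (a * b) = j b * j a) (f g : Lp A 1 μ) :
    reflect j (conv f g) = conv (reflect j g) (reflect j f) := by
  have hd := dense_setOf_ae_eq_hasCompactSupport (μ := μ) (E := A) ENNReal.one_ne_top
  refine hd.denseRange_val.induction_on₂
    (p := fun f g => reflect j (conv f g) = conv (reflect j g) (reflect j f))
    (isClosed_eq ?_ ?_) ?_ f g
  · have h := continuous_conv (μ := μ) (A := A)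
    fun_prop
  · have h := (continuous_conv (μ := μ) (A := B)).comp
      (((reflect j).continuous.comp continuous_snd).prodMk
        ((reflect j).continuous.comp continuous_fst))
    exact h
  · rintro ⟨f, φ, hφ, hφc, hf⟩ ⟨g, ψ, hψ, hψc, hg⟩
    exact reflect_conv_of_hasCompactSupport hj hφ hφc hf hψ hψc hg

theorem conv_eq_integral_rightMul_rightTranslate (f g : Lp A 1 μ) :
    conv f g = ∫ y, rightMul μ A (g y) (rightTranslate y⁻¹ f) ∂μ := by
  let j : A →ₗᵢ[ℂ] Aᵐᵒᵖ := (MulOpposite.opLinearIsometryEquiv ℂ A).toLinearIsometry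
  have hj : ∀ a b, j (a * b) = j b * j a := MulOpposite.op_mul
  apply (reflect j).injective
  rw [reflect_conv hj, conv, ← integral_inv_eq_self, ← (reflect j).integral_comp_comm]
  refine integral_congr_ae ?_
  filter_upwards [(Measure.measurePreserving_inv μ).quasiMeasurePreserving.ae
    (reflect_ae_of_ae_eq j (EventuallyEq.refl _ g))] with y hy
  rw [hy, inv_inv, reflect_rightMul_rightTranslate hj]

end RightConv

end GroupAlg

theorem isClosed_center {M : Type*} [Semigroup M] [TopologicalSpace M] [ContinuousMul M]
    [T2Space M] : IsClosed (Set.center M) := by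
  rw [← Set.centralizer_univ]
  exact Set.isClosed_centralizer _

section SetIntegral

variable {X N : Type*} [MeasurableSpace X] {μ : Measure X} [NormedAddCommGroup N] [NormedSpace ℝ N]
  [CompleteSpace N]

theorem eq_zero_of_forall_setIntegral_isCompact_isClosed [TopologicalSpace X] [R1Space X]
    [WeaklyLocallyCompactSpace X] [OpensMeasurableSpace X] [μ.IsOpenPosMeasure]
    [IsFiniteMeasureOnCompacts μ] {F : X → N} (hF : Continuous F)
    (h : ∀ K, IsCompact K → IsClosed K → ∫ x in K, F x ∂μ = 0) : F = 0 := by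
  ext t
  by_contra hFt
  have hpos : 0 < ‖F t‖ / 2 := half_pos (norm_pos_iff.2 hFt)
  obtain ⟨K, ⟨hKt, hK, hK_closed⟩, hKF⟩ := (isCompact_isClosed_basis_nhds t).mem_iff.1
    (hF.continuousAt.preimage_mem_nhds (Metric.ball_mem_nhds (F t) hpos))
  have hμK : 0 < μ.real K :=
    ENNReal.toReal_pos (Measure.measure_pos_of_mem_nhds μ hKt).ne' hK.measure_lt_top.ne
  have hle : ‖∫ x in K, (F x - F t) ∂μ‖ ≤ ‖F t‖ / 2 * μ.real K :=
    norm_setIntegral_le_of_norm_le_const hK.measure_lt_top fun x hx =>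
      (mem_ball_iff_norm.1 (hKF hx)).le
  rw [integral_sub (hF.continuousOn.integrableOn_compact' hK hK_closed.measurableSet)
    (integrableOn_const hK.measure_lt_top.ne), h K hK hK_closed, zero_sub, norm_neg,
    setIntegral_const, norm_smul, Real.norm_of_nonneg hμK.le] at hle
  nlinarith

theorem ae_mem_of_forall_setIntegral_mem {f : X → N} (hf : Integrable f μ) (Z : Submodule ℝ N)
    [hZ : IsClosed (Z : Set N)]
    (h : ∀ S, MeasurableSet S → μ S < ∞ → ∫ x in S, f x ∂μ ∈ Z) : ∀ᵐ x ∂μ, f x ∈ Z := by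
  suffices hq : (fun x => Z.mkQL (f x)) =ᵐ[μ] 0 from
    hq.mono fun x hx => (Submodule.Quotient.mk_eq_zero Z).1 hx
  refine (Z.mkQL.integrable_comp hf).ae_eq_zero_of_forall_setIntegral_eq_zero fun S hS hμS => ?_
  rw [Z.mkQL.integral_comp_comm hf.integrableOn]
  exact (Submodule.Quotient.mk_eq_zero Z).2 (h S hS hμS)

end SetIntegral

namespace GroupAlg

section Indicator

variable {G : Type*} [Group G] [TopologicalSpace G] [IsTopologicalGroup G]
  [MeasurableSpace G] [BorelSpace G] {μ : Measure G} [μ.IsHaarMeasure]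
  {A : Type*} [NonUnitalNormedRing A] [NormedSpace ℂ A] [IsScalarTower ℂ A A]
  [SMulCommClass ℂ A A]

theorem indicatorConstLp_conv {S : Set G} (hS : MeasurableSet S) (hμS : μ S ≠ ∞) (a : A)
    (f : Lp A 1 μ) :
    conv (indicatorConstLp 1 hS hμS a) f = ∫ y in S, leftMul μ A a (translate y f) ∂μ := by
  rw [conv, ← integral_indicator hS]
  refine integral_congr_ae ?_
  filter_upwards [indicatorConstLp_coeFn (p := 1) (hs := hS) (hμs := hμS) (c := a)] with y hy
  rw [hy]
  by_cases h : y ∈ S <;> simp [h]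

end Indicator

variable {G : Type*} [Group G] [TopologicalSpace G] [IsTopologicalGroup G]
  [LocallyCompactSpace G] [MeasurableSpace G] [BorelSpace G]
  {μ : Measure G} [μ.IsHaarMeasure] [μ.Regular]
  {A : Type*} [NonUnitalNormedRing A] [NormedSpace ℂ A] [IsScalarTower ℂ A A]
  [SMulCommClass ℂ A A]

theorem leftMul_eq_rightMul_of_ae_mem_center {f : Lp A 1 μ} (hf : ∀ᵐ x ∂μ, f x ∈ Set.center A)
    (a : A) : leftMul μ A a f = rightMul μ A a f := by
  apply Lp.ext
  filter_upwards [leftMul_ae a f, rightMul_ae a f, hf] with x hl hr hx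
  rw [hl, hr, Semigroup.mem_center_iff.1 hx]

theorem translate_inv_eq_rightTranslate_iff [μ.IsMulRightInvariant] {f : Lp A 1 μ} {y : G} :
    translate y⁻¹ f = rightTranslate y f ↔ (fun x => f (y * x * y⁻¹)) =ᵐ[μ] f := by
  have hl := translate_ae y⁻¹ f
  have hr := rightTranslate_ae y f
  rw [inv_inv] at hl
  have hy := fun y : G => (measurePreserving_mul_right μ y).quasiMeasurePreserving
  calc translate y⁻¹ f = rightTranslate y f
      ↔ (fun x => f (y * x)) =ᵐ[μ] fun x => f (x * y) :=
        ⟨fun h => hl.symm.trans (h ▸ hr), fun h => Lp.ext (hl.trans (h.trans hr.symm))⟩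
    _ ↔ (fun x => f (y * x * y⁻¹)) =ᵐ[μ] f := by
        refine ⟨fun h => ?_, fun h => ?_⟩
        · simpa [Function.comp_def, mul_assoc] using (hy y⁻¹).ae_eq_comp h
        · simpa [Function.comp_def, mul_assoc] using (hy y).ae_eq_comp h

section SetIntegral

variable [CompleteSpace A]

theorem setIntegral_leftMul (a : A) (f : Lp A 1 μ) (S : Set G) :
    ∫ x in S, leftMul μ A a f x ∂μ = a * ∫ x in S, f x ∂μ :=
  (integral_congr_ae (ae_restrict_of_ae (leftMul_ae a f))).trans
    ((ContinuousLinearMap.mul ℂ A a).integral_comp_comm (L1.integrable_coeFn f).integrableOn)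

theorem setIntegral_mem_center {f : Lp A 1 μ} (hf : ∀ a, leftMul μ A a f = rightMul μ A a f)
    (S : Set G) : ∫ x in S, f x ∂μ ∈ Set.center A :=
  Semigroup.mem_center_iff.2 fun a => by rw [← setIntegral_leftMul, ← setIntegral_rightMul, hf]

theorem forall_leftMul_eq_rightMul_iff {f : Lp A 1 μ} :
    (∀ a, leftMul μ A a f = rightMul μ A a f) ↔ ∀ᵐ x ∂μ, f x ∈ Set.center A := by
  refine ⟨fun hf => ?_, leftMul_eq_rightMul_of_ae_mem_center⟩
  let Z := (NonUnitalSubalgebra.center ℂ A).toSubmodule.restrictScalars ℝ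
  have : IsClosed (Z : Set A) := isClosed_center
  exact ae_mem_of_forall_setIntegral_mem (L1.integrable_coeFn f) Z
    fun S _ _ => setIntegral_mem_center hf S

theorem eq_zero_of_forall_leftMul_eq_zero (hA : ∀ z ∈ Set.center A, (∀ a, a * z = 0) → z = 0)
    {f : Lp A 1 μ} (hf : ∀ᵐ x ∂μ, f x ∈ Set.center A) (hf₀ : ∀ a, leftMul μ A a f = 0) :
    f = 0 := by
  rw [Lp.eq_zero_iff_ae_eq_zero]
  refine (L1.integrable_coeFn f).ae_eq_zero_of_forall_setIntegral_eq_zero fun S _ _ =>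
    hA _ (setIntegral_mem_center (forall_leftMul_eq_rightMul_iff.2 hf) S) fun a => ?_
  rw [← setIntegral_leftMul, hf₀]
  exact integral_eq_zero_of_ae (ae_restrict_of_ae (Lp.coeFn_zero A 1 μ))

theorem conv_indicatorConstLp [μ.IsMulRightInvariant] {S : Set G} (hS : MeasurableSet S)
    (hμS : μ S ≠ ∞) (a : A) (f : Lp A 1 μ) :
    conv f (indicatorConstLp 1 hS hμS a) =
      ∫ y in S, rightMul μ A a (rightTranslate y⁻¹ f) ∂μ := by
  rw [conv_eq_integral_rightMul_rightTranslate, ← integral_indicator hS]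
  refine integral_congr_ae ?_
  filter_upwards [indicatorConstLp_coeFn (p := 1) (hs := hS) (hμs := hμS) (c := a)] with y hy
  rw [hy]
  by_cases h : y ∈ S <;> simp [h]

end SetIntegral

section Center

variable [CompleteSpace A] [μ.IsMulRightInvariant] {f : Lp A 1 μ}

theorem leftMul_translate_eq_of_forall_conv_eq (hf : ∀ g, conv g f = conv f g) (a : A) (y : G) :
    leftMul μ A a (translate y f) = rightMul μ A a (rightTranslate y⁻¹ f) := by
  have hl : Continuous fun y => leftMul μ A a (translate y f) :=
    (leftMul μ A a).continuous.comp (continuous_translate f)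
  have hr : Continuous fun y : G => rightMul μ A a (rightTranslate y⁻¹ f) :=
    (rightMul μ A a).continuous.comp ((continuous_rightTranslate f).comp continuous_inv)
  refine sub_eq_zero.1 (congrFun (eq_zero_of_forall_setIntegral_isCompact_isClosed (μ := μ)
    (hl.sub hr) fun K hK hK_closed => ?_) y)
  have hKm := hK_closed.measurableSet
  simp only [Pi.sub_apply]
  rw [integral_sub (hl.continuousOn.integrableOn_compact' hK hKm)
    (hr.continuousOn.integrableOn_compact' hK hKm),
    ← indicatorConstLp_conv hKm hK.measure_lt_top.ne,
    ← conv_indicatorConstLp hKm hK.measure_lt_top.ne, hf, sub_self]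

theorem ae_mem_center_of_forall_conv_eq (hf : ∀ g, conv g f = conv f g) :
    ∀ᵐ x ∂μ, f x ∈ Set.center A := by
  have hl : translate 1 f = f := by
    apply Lp.ext
    filter_upwards [translate_ae 1 f] with x hx
    rw [hx, inv_one, one_mul]
  have hr : rightTranslate (1 : G)⁻¹ f = f := by
    apply Lp.ext
    filter_upwards [rightTranslate_ae (1 : G)⁻¹ f] with x hx
    rw [hx, inv_one, mul_one]
  refine forall_leftMul_eq_rightMul_iff.1 fun a => ?_
  simpa only [hl, hr] using leftMul_translate_eq_of_forall_conv_eq hf a 1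

theorem translate_eq_rightTranslate_of_forall_conv_eq
    (hA : ∀ z ∈ Set.center A, (∀ a, a * z = 0) → z = 0) (hf : ∀ g, conv g f = conv f g) (y : G) :
    translate y f = rightTranslate y⁻¹ f := by
  have hc := ae_mem_center_of_forall_conv_eq hf
  have hr : ∀ᵐ x ∂μ, rightTranslate y⁻¹ f x ∈ Set.center A := by
    filter_upwards [rightTranslate_ae y⁻¹ f,
      (measurePreserving_mul_right μ y⁻¹).quasiMeasurePreserving.ae hc] with x hx hcx
    rwa [hx]
  have hl : ∀ᵐ x ∂μ, translate y f x ∈ Set.center A := by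
    filter_upwards [translate_ae y f,
      (measurePreserving_mul_left μ y⁻¹).quasiMeasurePreserving.ae hc] with x hx hcx
    rwa [hx]
  refine sub_eq_zero.1 (eq_zero_of_forall_leftMul_eq_zero hA ?_ fun a => ?_)
  · filter_upwards [Lp.coeFn_sub (translate y f) (rightTranslate y⁻¹ f), hl, hr] with x hx hlx hrx
    rw [hx]
    exact (NonUnitalSubalgebra.center ℂ A).toSubmodule.sub_mem hlx hrx
  · rw [map_sub, leftMul_translate_eq_of_forall_conv_eq hf,
      leftMul_eq_rightMul_of_ae_mem_center hr, sub_self]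

theorem conv_comm_of_translate_eq_rightTranslate (hc : ∀ᵐ x ∂μ, f x ∈ Set.center A)
    (hf : ∀ y, translate y f = rightTranslate y⁻¹ f) (g : Lp A 1 μ) : conv g f = conv f g := by
  rw [conv_eq_integral_rightMul_rightTranslate f, conv]
  congr 1 with y : 1
  rw [← hf, leftMul_eq_rightMul_of_ae_mem_center]
  filter_upwards [translate_ae y f,
    (measurePreserving_mul_left μ y⁻¹).quasiMeasurePreserving.ae hc] with x hx hcx
  rwa [hx]

theorem mem_center_iff (hA : ∀ z ∈ Set.center A, (∀ a, a * z = 0) → z = 0) {f : GroupAlg μ A} :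
    f ∈ Set.center (GroupAlg μ A) ↔ (∀ᵐ x ∂μ, f.toLp x ∈ Set.center A) ∧
      ∀ y, (fun x => f.toLp (y * x * y⁻¹)) =ᵐ[μ] f.toLp := by
  simp only [← translate_inv_eq_rightTranslate_iff]
  rw [show f ∈ Set.center (GroupAlg μ A) ↔ ∀ g, conv g f.toLp = conv f.toLp g from
    Semigroup.mem_center_iff]
  refine ⟨fun hf => ⟨ae_mem_center_of_forall_conv_eq hf, fun y => ?_⟩,
    fun ⟨hc, hf⟩ => conv_comm_of_translate_eq_rightTranslate hc fun y => ?_⟩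
  · rw [translate_eq_rightTranslate_of_forall_conv_eq hA hf, inv_inv]
  · rw [← hf, inv_inv]

end Center

end GroupAlg

section CompLpRange

variable {X E F : Type*} {m m₀ : MeasurableSpace X} {μ : Measure X}
  [NormedAddCommGroup E] [NormedSpace ℂ E] [NormedAddCommGroup F] [NormedSpace ℂ F]

theorem mem_range_compLpₗᵢ_iff {j : E →ₗᵢ[ℂ] F} {f : Lp F 1 μ} :
    f ∈ Set.range (compLpₗᵢ (μ := μ) j) ↔ ∀ᵐ x ∂μ, f x ∈ Set.range j := by
  refine ⟨?_, fun hf => ?_⟩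
  · rintro ⟨u, rfl⟩
    filter_upwards [compLpₗᵢ_ae j u] with x hx using ⟨u x, hx.symm⟩
  · have hg : (fun x => j (Function.invFun j (f x))) =ᵐ[μ] f :=
      hf.mono fun x hx => Function.invFun_eq hx
    have hg_mem : MemLp (fun x => Function.invFun j (f x)) 1 μ := by
      refine (Lp.memLp f).congr_norm ?_ (hg.mono fun x hx => ?_)
      · rw [← j.isometry.isEmbedding.aestronglyMeasurable_comp_iff]
        exact (Lp.aestronglyMeasurable f).congr hg.symm
      · rw [← hx, j.norm_map, hx]
    refine ⟨hg_mem.toLp _, Lp.ext ((compLpₗᵢ_ae j _).trans ?_)⟩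
    filter_upwards [hg_mem.coeFn_toLp, hg] with x hx hgx
    rw [hx, hgx]

/-- The inclusion of the `L¹` space of a sub-`σ`-algebra. -/
noncomputable def lpTrimₗᵢ (hm : m ≤ m₀) : Lp E 1 (μ.trim hm) →ₗᵢ[ℂ] Lp E 1 μ :=
  (lpMeas E ℂ m 1 μ).subtypeₗᵢ.comp (lpMeasToLpTrimLie E ℂ 1 μ hm).symm.toLinearIsometry

theorem lpTrimₗᵢ_ae (hm : m ≤ m₀) (u : Lp E 1 (μ.trim hm)) : lpTrimₗᵢ hm u =ᵐ[μ] u :=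
  lpTrimToLpMeas_ae_eq (𝕜 := ℂ) hm u

theorem mem_range_lpTrimₗᵢ_iff {hm : m ≤ m₀} {f : Lp E 1 μ} :
    f ∈ Set.range (lpTrimₗᵢ (μ := μ) (E := E) hm) ↔ AEStronglyMeasurable[m] f μ := by
  refine ⟨?_, fun hf => ⟨lpMeasToLpTrimLie E ℂ 1 μ hm ⟨f, hf⟩, ?_⟩⟩
  · rintro ⟨u, rfl⟩
    exact ((lpMeasToLpTrimLie E ℂ 1 μ hm).symm u).2
  · exact congrArg Subtype.val ((lpMeasToLpTrimLie E ℂ 1 μ hm).symm_apply_apply ⟨f, hf⟩)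

theorem mem_range_lpTrimₗᵢ_comp_compLpₗᵢ_iff {hm : m ≤ m₀} {j : E →ₗᵢ[ℂ] F}
    (hj : IsClosed (Set.range j)) {f : Lp F 1 μ} :
    f ∈ Set.range ((lpTrimₗᵢ (μ := μ) hm).comp (compLpₗᵢ j)) ↔
      (∀ᵐ x ∂μ, f x ∈ Set.range j) ∧ AEStronglyMeasurable[m] f μ := by
  refine ⟨?_, fun ⟨hfj, hfm⟩ => ?_⟩
  · rintro ⟨u, rfl⟩
    refine ⟨?_, mem_range_lpTrimₗᵢ_iff.1 ⟨_, rfl⟩⟩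
    filter_upwards [lpTrimₗᵢ_ae hm (compLpₗᵢ j u),
      ae_eq_of_ae_eq_trim (compLpₗᵢ_ae j u)] with x hx hjx
    exact ⟨u x, (hx.trans hjx).symm⟩
  · obtain ⟨v, rfl⟩ := (mem_range_lpTrimₗᵢ_iff (hm := hm)).2 hfm
    suffices hv : ∀ᵐ x ∂μ.trim hm, v x ∈ Set.range j by
      obtain ⟨u, rfl⟩ := mem_range_compLpₗᵢ_iff.2 hv
      exact ⟨u, rfl⟩
    borelize F
    have hvm := (Lp.stronglyMeasurable v).measurable hj.measurableSet.compl
    refine (trim_measurableSet_eq hm hvm).trans (ae_iff.1 ?_)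
    filter_upwards [lpTrimₗᵢ_ae hm v, hfj] with x hx hxj
    rwa [← hx]

end CompLpRange

section AEInvariant

variable {X E : Type*} {m₀ m : MeasurableSpace X} {μ : Measure[m₀] X} {φ : X → X}

theorem comp_ae_eq_of_simpleFunc (f : SimpleFunc X E)
    (hφ : ∀ S, MeasurableSet[m] S → φ ⁻¹' S =ᵐ[μ] S) : f ∘ φ =ᵐ[μ] f := by
  have hfiber : ∀ v ∈ f.range, ∀ᵐ x ∂μ, f (φ x) = v ↔ f x = v := fun v _ =>
    (hφ _ (f.measurableSet_fiber v)).mem_iff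
  filter_upwards [(Finset.eventually_all _).2 hfiber] with x hx
  exact (hx _ (f.mem_range_self x)).2 rfl

theorem comp_ae_eq_of_stronglyMeasurable [TopologicalSpace E] [T2Space E] {f : X → E}
    (hf : StronglyMeasurable[m] f) (hφ : ∀ S, MeasurableSet[m] S → φ ⁻¹' S =ᵐ[μ] S) :
    f ∘ φ =ᵐ[μ] f := by
  filter_upwards [ae_all_iff.2 fun n => comp_ae_eq_of_simpleFunc (hf.approx n) hφ] with x hx
  refine tendsto_nhds_unique (hf.tendsto_approx (φ x)) ?_
  exact (hf.tendsto_approx x).congr fun n => (hx n).symm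

end AEInvariant

section ConjInvariant

variable {G : Type*} [Group G] [MeasurableSpace G]

/-- The `σ`-algebra of the measurable sets which are invariant under every inner automorphism, up to
null sets (which may depend on the automorphism). -/
@[reducible] def conjInvariant (μ : Measure G) : MeasurableSpace G where
  MeasurableSet' S := MeasurableSet S ∧ ∀ y : G, (fun x => y * x * y⁻¹) ⁻¹' S =ᵐ[μ] S
  measurableSet_empty := ⟨MeasurableSet.empty, fun _ => EventuallyEq.rfl⟩
  measurableSet_compl _ hS := ⟨hS.1.compl, fun y => (hS.2 y).compl⟩
  measurableSet_iUnion S hS := ⟨MeasurableSet.iUnion fun i => (hS i).1, fun y => by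
    rw [Set.preimage_iUnion]
    exact Filter.EventuallyEq.countable_iUnion fun i => (hS i).2 y⟩

theorem conjInvariant_le (μ : Measure G) : conjInvariant μ ≤ ‹MeasurableSpace G› :=
  fun _ hS => hS.1

variable {μ : Measure G} {E : Type*} [TopologicalSpace E] {f : G → E}

theorem stronglyMeasurable_conjInvariant [TopologicalSpace.PseudoMetrizableSpace E]
    (hf : StronglyMeasurable f) (h : ∀ y : G, (fun x => f (y * x * y⁻¹)) =ᵐ[μ] f) :
    StronglyMeasurable[conjInvariant μ] f := by
  borelize E
  exact stronglyMeasurable_iff_measurable_separable.2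
    ⟨fun U hU => ⟨hf.measurable hU, fun y => (h y).preimage U⟩, hf.isSeparable_range⟩

theorem aestronglyMeasurable_conjInvariant_iff [MeasurableMul G] [μ.IsMulLeftInvariant]
    [μ.IsMulRightInvariant] [TopologicalSpace.MetrizableSpace E] (hf : AEStronglyMeasurable f μ) :
    AEStronglyMeasurable[conjInvariant μ] f μ ↔
      ∀ y : G, (fun x => f (y * x * y⁻¹)) =ᵐ[μ] f := by
  have hconj (y : G) : Measure.QuasiMeasurePreserving (fun x => y * x * y⁻¹) μ μ :=
    ((measurePreserving_mul_right μ y⁻¹).comp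
      (measurePreserving_mul_left μ y)).quasiMeasurePreserving
  refine ⟨?_, fun h => ⟨hf.mk f, ?_, hf.ae_eq_mk⟩⟩
  · rintro ⟨g, hg, hfg⟩ y
    exact ((hconj y).ae_eq_comp hfg).trans
      ((comp_ae_eq_of_stronglyMeasurable hg fun S hS => hS.2 y).trans hfg.symm)
  · exact stronglyMeasurable_conjInvariant hf.stronglyMeasurable_mk fun y =>
      ((hconj y).ae_eq_comp hf.ae_eq_mk).symm.trans ((h y).trans hf.ae_eq_mk)

end ConjInvariant

namespace GroupAlg

variable {G : Type*} [Group G] [TopologicalSpace G] [IsTopologicalGroup G]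
  [LocallyCompactSpace G] [MeasurableSpace G] [BorelSpace G]
  {μ : Measure G} [μ.IsHaarMeasure] [μ.Regular] [μ.IsMulRightInvariant]
  {A : Type*} [NonUnitalNormedRing A] [NormedSpace ℂ A] [IsScalarTower ℂ A A]
  [SMulCommClass ℂ A A] [CompleteSpace A]
  {E : Type*} [NormedAddCommGroup E] [NormedSpace ℂ E] {j : E →ₗᵢ[ℂ] A}

theorem range_lpTrimₗᵢ_comp_compLpₗᵢ_eq_center (hA : ∀ z ∈ Set.center A, (∀ a, a * z = 0) → z = 0)
    (hj : Set.range j = Set.center A) :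
    Set.range ((lpTrimₗᵢ (conjInvariant_le μ)).comp (compLpₗᵢ j)) =
      Set.center (GroupAlg μ A) := by
  ext f
  rw [mem_range_lpTrimₗᵢ_comp_compLpₗᵢ_iff (hj ▸ isClosed_center), hj,
    aestronglyMeasurable_conjInvariant_iff (Lp.aestronglyMeasurable f)]
  exact (mem_center_iff hA).symm

/-- The centre of `L¹(G, A)`, as the `L¹` space of conjugation invariant functions with values in a
copy `j : E → A` of the centre of `A`. -/
noncomputable def centerEquiv (hA : ∀ z ∈ Set.center A, (∀ a, a * z = 0) → z = 0)
    (hj : Set.range j = Set.center A) :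
    Lp E 1 (μ.trim (conjInvariant_le μ)) ≃ₗᵢ[ℂ] NonUnitalSubalgebra.center ℂ (GroupAlg μ A) :=
  have h := range_lpTrimₗᵢ_comp_compLpₗᵢ_eq_center (μ := μ) hA hj
  let T := (lpTrimₗᵢ (conjInvariant_le μ)).comp (compLpₗᵢ j)
  LinearIsometryEquiv.ofSurjective
    { toFun := fun u => ⟨T u, h.subset ⟨u, rfl⟩⟩
      map_add' := fun u v => Subtype.ext (T.map_add u v)
      map_smul' := fun c u => Subtype.ext (T.map_smul c u)
      norm_map' := T.norm_map }
    fun f => (h.superset f.2).imp fun _ => Subtype.ext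

theorem centerEquiv_ae (hA : ∀ z ∈ Set.center A, (∀ a, a * z = 0) → z = 0)
    (hj : Set.range j = Set.center A) (u : Lp E 1 (μ.trim (conjInvariant_le μ))) :
    (centerEquiv hA hj u : GroupAlg μ A).toLp =ᵐ[μ] fun x => j (u x) :=
  (lpTrimₗᵢ_ae _ _).trans (ae_eq_of_ae_eq_trim (compLpₗᵢ_ae j u))

end GroupAlg

namespace GroupAlg

section SmulL

variable {G : Type*} [Group G] [TopologicalSpace G] [IsTopologicalGroup G]
  [LocallyCompactSpace G] [MeasurableSpace G] [BorelSpace G]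
  {μ : Measure G} [μ.IsHaarMeasure] [μ.Regular]
  {A : Type*} [NonUnitalNormedRing A] [NormedSpace ℂ A] [IsScalarTower ℂ A A]
  [SMulCommClass ℂ A A]

theorem leftMul_translate_smulL (c : ℂ) (z w : A) (y : G) (g : Lp ℂ 1 μ) :
    leftMul μ A (c • z) (translate y (ProjTensor.smulL μ A g w)) =
      ProjTensor.smulL μ A (leftMul μ ℂ c (translate y g)) (z * w) := by
  apply Lp.ext
  have h := (measurePreserving_mul_left μ y⁻¹).quasiMeasurePreserving.ae_eq_comp
    (ProjTensor.smulL_ae g w)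
  filter_upwards [h, leftMul_ae (c • z) (translate y (ProjTensor.smulL μ A g w)),
    translate_ae y (ProjTensor.smulL μ A g w), leftMul_ae c (translate y g), translate_ae y g,
    ProjTensor.smulL_ae (leftMul μ ℂ c (translate y g)) (z * w)] with x h₁ h₂ h₃ h₄ h₅ h₆
  simp only [Function.comp_apply] at h₁
  rw [h₂, h₃, h₁, h₆, h₄, h₅, smul_mul_smul_comm]

theorem conv_smulL [CompleteSpace A] (f g : Lp ℂ 1 μ) (z w : A) :
    conv (ProjTensor.smulL μ A f z) (ProjTensor.smulL μ A g w) =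
      ProjTensor.smulL μ A (conv f g) (z * w) := by
  have h := ((ProjTensor.smulL μ A).flip (z * w)).integral_comp_comm (integrable_conv' f g)
  simp only [ContinuousLinearMap.flip_apply] at h
  rw [conv, conv, ← h]
  refine integral_congr_ae ?_
  filter_upwards [ProjTensor.smulL_ae f z] with y hy
  rw [hy, leftMul_translate_smulL]

end SmulL

section CenterTensor

variable {G : Type*} [Group G] [TopologicalSpace G] [IsTopologicalGroup G]
  [LocallyCompactSpace G] [MeasurableSpace G] [BorelSpace G]
  {μ : Measure G} [μ.IsHaarMeasure] [μ.Regular] [μ.IsMulRightInvariant]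
  {A : Type*} [NonUnitalNormedRing A] [NormedSpace ℂ A] [IsScalarTower ℂ A A]
  [SMulCommClass ℂ A A] [CompleteSpace A]

variable (μ) in
/-- The centre of `L¹(G)`, as the `L¹` space of conjugation invariant functions. -/
noncomputable def scalarCenterEquiv :
    Lp ℂ 1 (μ.trim (conjInvariant_le μ)) ≃ₗᵢ[ℂ] NonUnitalSubalgebra.center ℂ (GroupAlg μ ℂ) :=
  centerEquiv (j := LinearIsometry.id) (fun z _ hz => (one_mul z).symm.trans (hz 1))
    (by simp [Set.center_eq_univ])

theorem scalarCenterEquiv_symm_ae (f : NonUnitalSubalgebra.center ℂ (GroupAlg μ ℂ)) :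
    (scalarCenterEquiv μ).symm f =ᵐ[μ] (f : GroupAlg μ ℂ).toLp := by
  have h := centerEquiv_ae (μ := μ) (j := LinearIsometry.id)
    (fun z _ hz => (one_mul z).symm.trans (hz 1)) (by simp [Set.center_eq_univ])
    ((scalarCenterEquiv μ).symm f)
  exact (h.symm.trans (by rw [← scalarCenterEquiv, LinearIsometryEquiv.apply_symm_apply]))

variable {E : Type*} [NormedAddCommGroup E] [NormedSpace ℂ E] [CompleteSpace E]
  {j : E →ₗᵢ[ℂ] A}

/-- The isomorphism `Z(L¹(G)) ⊗^γ Z(A) ≃ Z(L¹(G, A))`, for a copy `j : E → A` of the centre of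
`A`. It is `L¹(ν) ⊗^γ E ≃ L¹(ν, E)` for the restriction `ν` of `μ` to the conjugation invariant
sets. -/
noncomputable def centerTensorEquiv (hA : ∀ z ∈ Set.center A, (∀ a, a * z = 0) → z = 0)
    (hj : Set.range j = Set.center A) :
    ProjTensor (NonUnitalSubalgebra.center ℂ (GroupAlg μ ℂ)) E ≃ₗᵢ[ℂ]
      NonUnitalSubalgebra.center ℂ (GroupAlg μ A) :=
  ((ProjTensor.congr (scalarCenterEquiv μ).symm (.refl ℂ E)).trans (ProjTensor.l1Equiv _ E)).trans
    (centerEquiv hA hj)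

theorem centerTensorEquiv_tmul_ae (hA : ∀ z ∈ Set.center A, (∀ a, a * z = 0) → z = 0)
    (hj : Set.range j = Set.center A) (f : NonUnitalSubalgebra.center ℂ (GroupAlg μ ℂ)) (z : E) :
    (centerTensorEquiv hA hj (ProjTensor.tmul f z) : GroupAlg μ A).toLp =ᵐ[μ]
      fun x => (f : GroupAlg μ ℂ).toLp x • j z := by
  have htmul : centerTensorEquiv hA hj (ProjTensor.tmul f z) =
      centerEquiv hA hj (ProjTensor.smulL _ E ((scalarCenterEquiv μ).symm f) z) := by
    simp only [centerTensorEquiv, LinearIsometryEquiv.trans_apply, ProjTensor.congr_tmul,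
      LinearIsometryEquiv.coe_refl, id_eq, ProjTensor.l1Equiv_tmul]
  rw [htmul]
  filter_upwards [centerEquiv_ae hA hj (ProjTensor.smulL _ E ((scalarCenterEquiv μ).symm f) z),
    ae_eq_of_ae_eq_trim (ProjTensor.smulL_ae ((scalarCenterEquiv μ).symm f) z),
    scalarCenterEquiv_symm_ae f] with x h₁ h₂ h₃
  rw [h₁, h₂, h₃, map_smul]

theorem centerTensorEquiv_tmul (hA : ∀ z ∈ Set.center A, (∀ a, a * z = 0) → z = 0)
    (hj : Set.range j = Set.center A) (f : NonUnitalSubalgebra.center ℂ (GroupAlg μ ℂ)) (z : E) :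
    (centerTensorEquiv hA hj (ProjTensor.tmul f z) : GroupAlg μ A).toLp =
      ProjTensor.smulL μ A (f : GroupAlg μ ℂ).toLp (j z) :=
  Lp.ext ((centerTensorEquiv_tmul_ae hA hj f z).trans (ProjTensor.smulL_ae _ _).symm)

theorem centerTensorEquiv_mul {E : Type*} [NonUnitalNormedRing E] [NormedSpace ℂ E]
    [IsScalarTower ℂ E E] [SMulCommClass ℂ E E] [CompleteSpace E] {j : E →ₗᵢ[ℂ] A}
    (hA : ∀ z ∈ Set.center A, (∀ a, a * z = 0) → z = 0)
    (hj : Set.range j = Set.center A) (hmul : ∀ z w, j (z * w) = j z * j w)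
    (u v : ProjTensor (NonUnitalSubalgebra.center ℂ (GroupAlg μ ℂ)) E) :
    centerTensorEquiv hA hj (u * v) = centerTensorEquiv hA hj u * centerTensorEquiv hA hj v := by
  refine ProjTensor.map_mul_of_tmul (R := NonUnitalSubalgebra.center ℂ (GroupAlg μ A))
    (centerTensorEquiv (μ := μ) hA hj).toContinuousLinearEquiv (fun f z g w => Subtype.ext ?_) u v
  change (centerTensorEquiv (μ := μ) hA hj _ : GroupAlg μ A).toLp = conv
    (centerTensorEquiv hA hj (ProjTensor.tmul f z) : GroupAlg μ A).toLp
    (centerTensorEquiv hA hj (ProjTensor.tmul g w) : GroupAlg μ A).toLp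
  rw [centerTensorEquiv_tmul, centerTensorEquiv_tmul, centerTensorEquiv_tmul, conv_smulL, hmul]
  rfl

end CenterTensor

end GroupAlg

theorem IsBoundedCenterApproxIdentity.eq_zero_of_forall_mul_eq_zero {A ι : Type*}
    [NonUnitalNormedRing A] [Preorder ι] [IsDirectedOrder ι] [Nonempty ι] {a : ι → A}
    (ha : IsBoundedCenterApproxIdentity a) {z : A} (hz : z ∈ Set.center A)
    (h : ∀ b, b * z = 0) : z = 0 := by
  refine tendsto_nhds_unique (ha.2 z hz) ?_
  simpa only [h] using tendsto_const_nhds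

theorem mainTheorem2_general {G : Type*} [Group G] [TopologicalSpace G] [IsTopologicalGroup G]
    [LocallyCompactSpace G] [MeasurableSpace G] [BorelSpace G]
    (μ : Measure G) [μ.IsHaarMeasure] [μ.Regular] [μ.IsMulRightInvariant]
    {A : Type*} [NonUnitalNormedRing A] [NormedSpace ℂ A] [IsScalarTower ℂ A A]
    [SMulCommClass ℂ A A] [CompleteSpace A]
    (hA : ∀ z ∈ Set.center A, (∀ a, a * z = 0) → z = 0) :
    ∃ Φ : ProjTensor (NonUnitalSubalgebra.center ℂ (GroupAlg μ ℂ)) (NonUnitalSubalgebra.center ℂ A)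
        ≃ₗᵢ[ℂ] NonUnitalSubalgebra.center ℂ (GroupAlg μ A),
      (∀ u v, Φ (u * v) = Φ u * Φ v) ∧
      ∀ (f : NonUnitalSubalgebra.center ℂ (GroupAlg μ ℂ)) (z : NonUnitalSubalgebra.center ℂ A),
        ⇑(Φ (ProjTensor.tmul f z) : GroupAlg μ A).toLp =ᵐ[μ]
          fun x => (f : GroupAlg μ ℂ).toLp x • (z : A) :=
  have : CompleteSpace (NonUnitalSubalgebra.center ℂ A) := isClosed_center.completeSpace_coe
  let j : NonUnitalSubalgebra.center ℂ A →ₗᵢ[ℂ] A :=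
    { toFun := Subtype.val
      map_add' := fun _ _ => rfl
      map_smul' := fun _ _ => rfl
      norm_map' := fun _ => rfl }
  have hj : Set.range j = Set.center A := Subtype.range_coe
  ⟨GroupAlg.centerTensorEquiv hA hj, GroupAlg.centerTensorEquiv_mul hA hj fun _ _ => rfl,
    GroupAlg.centerTensorEquiv_tmul_ae hA hj⟩

/-- For an [IN] group `G` and a Banach algebra `A` with a bounded `Z(A)`-approximate identity,
`f ⊗ a ↦ f(·) a` extends to an isometric algebra isomorphism of `Z(L¹(G)) ⊗^γ Z(A)` onto
`Z(L¹(G, A))`. -/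
theorem mainTheorem2 {G : Type*} [Group G] [TopologicalSpace G] [IsTopologicalGroup G]
    [LocallyCompactSpace G] [T2Space G] [MeasurableSpace G] [BorelSpace G]
    (μ : Measure G) [μ.IsHaarMeasure] [μ.Regular] (hG : IsINGroup G)
    {A : Type*} [NonUnitalNormedRing A] [NormedSpace ℂ A] [IsScalarTower ℂ A A]
    [SMulCommClass ℂ A A] [CompleteSpace A]
    {ι : Type*} [Preorder ι] [IsDirectedOrder ι] [Nonempty ι] (a : ι → A)
    (ha : IsBoundedCenterApproxIdentity a) :
    ∃ Φ : ProjTensor (NonUnitalSubalgebra.center ℂ (GroupAlg μ ℂ)) (NonUnitalSubalgebra.center ℂ A)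
        ≃ₗᵢ[ℂ] NonUnitalSubalgebra.center ℂ (GroupAlg μ A),
      (∀ u v, Φ (u * v) = Φ u * Φ v) ∧
      ∀ (f : NonUnitalSubalgebra.center ℂ (GroupAlg μ ℂ)) (z : NonUnitalSubalgebra.center ℂ A),
        ⇑(Φ (ProjTensor.tmul f z) : GroupAlg μ A).toLp =ᵐ[μ]
          fun x => (f : GroupAlg μ ℂ).toLp x • (z : A) := by
  have : μ.IsMulRightInvariant := hG.isMulRightInvariant μ
  exact mainTheorem2_general μ fun _ => ha.eq_zero_of_forall_mul_eq_zero
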